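/- For a real Lie algebra $\mathfrak g$ with a finite basis $X_1,\dots,X_n$ and structure constants $[X_i,X_j]=\sum_k C_{ij}^kX_k$, let $x_1,\dots,x_n$ be the corresponding linear coordinates on $\mathfrak g^*$ and put $$\mathcal N(\mathfrak g):=\dim\mathfrak g-\sup_{x}\operatorname{rank}\Big(\sum_k C_{ij}^kx_k\Big)_{1\le i,j\le n}.$$ An invariant of $\mathfrak g$ on an open set $U\subseteq\mathfrak g^*$ is a $C^\infty$ function $F$ on $U$ with $\sum_{j,k}C_{ij}^kx_k\,\partial F/\partial x_j=0$ on $U$ for all $i$. Finitely many functions are functionally independent on $U$ if their differentials are linearly independent at all points of a dense subset of $U$. For $N\ge 1$ let $QHa(N)$ be the real Lie algebra with generators $J_{ij}=-J_{ji}$, $G_k,F_k,P_k,Q_k$ ($1\le i,j,k\le N$) and $R,E,T,L,A,M$, where the $J_{ij}$ with $i<j$ and the other generators form a basis, and with brackets $$[J_{ij},J_{kl}]=\delta_{il}J_{jk}+\delta_{jk}J_{il}-\delta_{jl}J_{ik}-\delta_{ik}J_{jl},\qquad [J_{ij},V_k]=-\delta_{ik}V_j+\delta_{jk}V_i\quad(V=G,F,P,Q),$$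 $$[G_i,F_j]=\delta_{ij}R,\quad [G_i,Q_j]=[F_i,P_j]=\delta_{ij}T,\quad [P_i,Q_j]=\delta_{ij}L,\quad [G_i,P_j]=\delta_{ij}M,\quad [F_i,Q_j]=\delta_{ij}A,$$ $$[E,G_i]=-P_i,\quad [E,F_i]=Q_i,\quad [E,T]=-L,\quad [E,R]=2T,$$ all other brackets of generators (up to antisymmetry) being zero. It is a central extension, by $L,A,M$, of the inhomogeneous Hamilton algebra $IHa(N)$, whose brackets are obtained by omitting $L,A,M$. Then for every $N\ge3$ (and every basis of $QHa(N)$) $$\mathcal N(QHa(N))=\left[\tfrac N2\right]+4,$$ and on every nonempty open subset of $QHa(N)^*$ (in particular on all of $QHa(N)^*$) the maximal number of functionally independent invariants of $QHa(N)$ is $\left[\tfrac N2\right]+4$. -/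

import Mathlib

open Matrix
open scoped ContDiff

/-! ### Invariants of a real Lie algebra over a basis -/

namespace LieInvariants

variable {ι 𝔤 : Type*} [LieRing 𝔤] [LieAlgebra ℝ 𝔤]

/-- The structure constants `C_{ij}^k` of `𝔤` over the basis `X`:
`[X_i, X_j] = ∑ k, C_{ij}^k X_k`. -/
noncomputable def structConst (X : Module.Basis ι ℝ 𝔤) (i j k : ι) : ℝ :=
  X.repr ⁅X i, X j⁆ k

/-- The matrix `A(𝔤) = (∑ k, C_{ij}^k x_k)` of the commutator table, at the point of `𝔤*` whose
linear coordinates are `x`. -/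
noncomputable def commutatorMatrix [Fintype ι] (X : Module.Basis ι ℝ 𝔤) (x : ι → ℝ) :
    Matrix ι ι ℝ :=
  Matrix.of fun i j => ∑ k, structConst X i j k * x k

/-- `𝒩(𝔤) = dim 𝔤 - sup_x rank (C_{ij}^k x_k)`. The rank of a square matrix of size `dim 𝔤` is at
most `dim 𝔤`, so the supremum is that of a nonempty bounded set and the subtraction does not
truncate. -/
noncomputable def invariantNumber [Fintype ι] (X : Module.Basis ι ℝ 𝔤) : ℕ :=
  Module.finrank ℝ 𝔤 - ⨆ x : ι → ℝ, (commutatorMatrix X x).rank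

/-- The differential operator `X̂_i = C_{ij}^k x_k ∂/∂x_j` applied to `F` at the point `x`. -/
noncomputable def analyticRealization [Fintype ι] [DecidableEq ι] (X : Module.Basis ι ℝ 𝔤) (i : ι)
    (F : (ι → ℝ) → ℝ) (x : ι → ℝ) : ℝ :=
  ∑ j, commutatorMatrix X x i j * fderiv ℝ F x (Pi.single j 1)

/-- `F` is an invariant of `𝔤` on the open set `U` of `𝔤*`: a smooth solution on `U` of the system
`X̂_i F = 0` for all `i`. -/
def IsInvariantOn [Fintype ι] [DecidableEq ι] (X : Module.Basis ι ℝ 𝔤) (U : Set (ι → ℝ))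
    (F : (ι → ℝ) → ℝ) : Prop :=
  ContDiffOn ℝ ∞ F U ∧ ∀ i, ∀ x ∈ U, analyticRealization X i F x = 0

/-- Functions `F₁, …, F_k` are functionally independent on the open set `U`: their differentials
are linearly independent at the points of a dense subset of `U`. -/
def FunctionallyIndependentOn [Fintype ι] (U : Set (ι → ℝ)) {k : ℕ}
    (F : Fin k → (ι → ℝ) → ℝ) : Prop :=
  U ⊆ closure {x ∈ U | LinearIndependent ℝ fun a => fderiv ℝ (F a) x}

/-- `k` is the maximal number of functionally independent invariants of `𝔤` on `U`. -/
def IsMaxNumberOfInvariantsOn [Fintype ι] [DecidableEq ι] (X : Module.Basis ι ℝ 𝔤)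
    (U : Set (ι → ℝ)) (k : ℕ) : Prop :=
  IsGreatest {m : ℕ | ∃ F : Fin m → (ι → ℝ) → ℝ,
    (∀ a, IsInvariantOn X U (F a)) ∧ FunctionallyIndependentOn U F} k

end LieInvariants

/-! ### The inhomogeneous Hamilton algebra -/

/-- The underlying space of `IHa(N)`. The element with components `(j, g, f, p, q, r, e, t)` stands
for `∑_{i<k} j_{ik} J_{ik} + ∑_k (g_k G_k + f_k F_k + p_k P_k + q_k Q_k) + r R + e E + t T`. The
rotation part is the Lie algebra of skew-symmetric matrices, the generator `J_{ik}` being the matrix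
with entry `1` at `(i, k)`, entry `-1` at `(k, i)`, and `0` elsewhere. -/
@[ext]
structure IHa (N : ℕ) where
  /-- Rotations. -/
  J : LieAlgebra.Orthogonal.so (Fin N) ℝ
  /-- Coefficients of the `G_k`. -/
  G : Fin N → ℝ
  /-- Coefficients of the `F_k`. -/
  F : Fin N → ℝ
  /-- Coefficients of the `P_k`. -/
  P : Fin N → ℝ
  /-- Coefficients of the `Q_k`. -/
  Q : Fin N → ℝ
  /-- Coefficient of `R`. -/
  R : ℝ
  /-- Coefficient of `E`. -/
  E : ℝ
  /-- Coefficient of `T`. -/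
  T : ℝ

namespace IHa

variable {N : ℕ}

/-- The components of an element, as a tuple. -/
def equivProd (N : ℕ) : IHa N ≃ LieAlgebra.Orthogonal.so (Fin N) ℝ ×
    ((Fin N → ℝ) × (Fin N → ℝ) × (Fin N → ℝ) × (Fin N → ℝ)) × (ℝ × ℝ × ℝ) where
  toFun x := (x.J, (x.G, x.F, x.P, x.Q), (x.R, x.E, x.T))
  invFun y := ⟨y.1, y.2.1.1, y.2.1.2.1, y.2.1.2.2.1, y.2.1.2.2.2, y.2.2.1, y.2.2.2.1, y.2.2.2.2⟩
  left_inv _ := rfl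
  right_inv _ := rfl

/-- Componentwise addition. -/
noncomputable instance : AddCommGroup (IHa N) := (equivProd N).addCommGroup

/-- Componentwise scalar multiplication. -/
noncomputable instance : Module ℝ (IHa N) := (equivProd N).module ℝ

@[simp] theorem add_J (x y : IHa N) : (x + y).J = x.J + y.J := rfl
@[simp] theorem add_G (x y : IHa N) : (x + y).G = x.G + y.G := rfl
@[simp] theorem add_F (x y : IHa N) : (x + y).F = x.F + y.F := rfl
@[simp] theorem add_P (x y : IHa N) : (x + y).P = x.P + y.P := rfl
@[simp] theorem add_Q (x y : IHa N) : (x + y).Q = x.Q + y.Q := rfl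
@[simp] theorem add_R (x y : IHa N) : (x + y).R = x.R + y.R := rfl
@[simp] theorem add_E (x y : IHa N) : (x + y).E = x.E + y.E := rfl
@[simp] theorem add_T (x y : IHa N) : (x + y).T = x.T + y.T := rfl
@[simp] theorem zero_J : (0 : IHa N).J = 0 := rfl
@[simp] theorem zero_G : (0 : IHa N).G = 0 := rfl
@[simp] theorem zero_F : (0 : IHa N).F = 0 := rfl
@[simp] theorem zero_P : (0 : IHa N).P = 0 := rfl
@[simp] theorem zero_Q : (0 : IHa N).Q = 0 := rfl
@[simp] theorem zero_R : (0 : IHa N).R = 0 := rfl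
@[simp] theorem zero_E : (0 : IHa N).E = 0 := rfl
@[simp] theorem zero_T : (0 : IHa N).T = 0 := rfl
@[simp] theorem smul_J (c : ℝ) (x : IHa N) : (c • x).J = c • x.J := rfl
@[simp] theorem smul_G (c : ℝ) (x : IHa N) : (c • x).G = c • x.G := rfl
@[simp] theorem smul_F (c : ℝ) (x : IHa N) : (c • x).F = c • x.F := rfl
@[simp] theorem smul_P (c : ℝ) (x : IHa N) : (c • x).P = c • x.P := rfl
@[simp] theorem smul_Q (c : ℝ) (x : IHa N) : (c • x).Q = c • x.Q := rfl
@[simp] theorem smul_R (c : ℝ) (x : IHa N) : (c • x).R = c * x.R := rfl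
@[simp] theorem smul_E (c : ℝ) (x : IHa N) : (c • x).E = c * x.E := rfl
@[simp] theorem smul_T (c : ℝ) (x : IHa N) : (c • x).T = c * x.T := rfl

/-- The bracket with `[J_{ij}, J_{kl}] = δ_i^l J_{jk} + δ_j^k J_{il} - δ_j^l J_{ik} - δ_i^k J_{jl}`,
`[J_{ij}, V_k] = -δ_i^k V_j + δ_k^j V_i` for `V = G, F, P, Q`, `[G_i, F_j] = δ_i^j R`,
`[G_i, Q_j] = δ_i^j T`, `[F_i, P_j] = δ_i^j T`, `[E, G_i] = -P_i`, `[E, F_i] = Q_i`,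
`[E, R] = 2T`, and all other brackets of generators zero. -/
noncomputable instance : Bracket (IHa N) (IHa N) where
  bracket x y :=
    { J := ⁅x.J, y.J⁆
      G := x.J.1 *ᵥ y.G - y.J.1 *ᵥ x.G
      F := x.J.1 *ᵥ y.F - y.J.1 *ᵥ x.F
      P := x.J.1 *ᵥ y.P - y.J.1 *ᵥ x.P - (x.E • y.G - y.E • x.G)
      Q := x.J.1 *ᵥ y.Q - y.J.1 *ᵥ x.Q + (x.E • y.F - y.E • x.F)
      R := x.G ⬝ᵥ y.F - y.G ⬝ᵥ x.F
      E := 0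
      T := (x.G ⬝ᵥ y.Q - y.G ⬝ᵥ x.Q) + (x.F ⬝ᵥ y.P - y.F ⬝ᵥ x.P)
        + 2 * (x.E * y.R - y.E * x.R) }

theorem bracket_J (x y : IHa N) : ⁅x, y⁆.J = ⁅x.J, y.J⁆ := rfl
theorem bracket_G (x y : IHa N) : ⁅x, y⁆.G = x.J.1 *ᵥ y.G - y.J.1 *ᵥ x.G := rfl
theorem bracket_F (x y : IHa N) : ⁅x, y⁆.F = x.J.1 *ᵥ y.F - y.J.1 *ᵥ x.F := rfl
theorem bracket_P (x y : IHa N) :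
    ⁅x, y⁆.P = x.J.1 *ᵥ y.P - y.J.1 *ᵥ x.P - (x.E • y.G - y.E • x.G) := rfl
theorem bracket_Q (x y : IHa N) :
    ⁅x, y⁆.Q = x.J.1 *ᵥ y.Q - y.J.1 *ᵥ x.Q + (x.E • y.F - y.E • x.F) := rfl
theorem bracket_R (x y : IHa N) : ⁅x, y⁆.R = x.G ⬝ᵥ y.F - y.G ⬝ᵥ x.F := rfl
theorem bracket_E (x y : IHa N) : ⁅x, y⁆.E = 0 := rfl
theorem bracket_T (x y : IHa N) :
    ⁅x, y⁆.T = (x.G ⬝ᵥ y.Q - y.G ⬝ᵥ x.Q) + (x.F ⬝ᵥ y.P - y.F ⬝ᵥ x.P)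
      + 2 * (x.E * y.R - y.E * x.R) := rfl

theorem so_bracket (A B : LieAlgebra.Orthogonal.so (Fin N) ℝ) :
    (⁅A, B⁆ : LieAlgebra.Orthogonal.so (Fin N) ℝ).1 = A.1 * B.1 - B.1 * A.1 := rfl

/-- Skew-symmetry of the rotation part. -/
theorem so_mulVec_dotProduct (A : LieAlgebra.Orthogonal.so (Fin N) ℝ) (u v : Fin N → ℝ) :
    (A.1 *ᵥ u) ⬝ᵥ v = -(u ⬝ᵥ (A.1 *ᵥ v)) := by
  have h : A.1ᵀ = -A.1 := (LieAlgebra.Orthogonal.mem_so (Fin N) ℝ A.1).1 A.2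
  rw [dotProduct_comm, dotProduct_mulVec, ← mulVec_transpose, h, neg_mulVec, neg_dotProduct,
    dotProduct_comm]

noncomputable instance : LieRing (IHa N) where
  add_lie x y z := by
    ext1 <;> simp [bracket_J, bracket_G, bracket_F, bracket_P, bracket_Q, bracket_R, bracket_E,
      bracket_T, add_mulVec, mulVec_add, add_smul, add_dotProduct, dotProduct_add] <;>
      first | done | module | ring
  lie_add x y z := by
    ext1 <;> simp [bracket_J, bracket_G, bracket_F, bracket_P, bracket_Q, bracket_R, bracket_E,
      bracket_T, add_mulVec, mulVec_add, add_smul, add_dotProduct, dotProduct_add] <;>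
      first | done | module | ring
  lie_self x := by
    ext1 <;> simp [bracket_J, bracket_G, bracket_F, bracket_P, bracket_Q, bracket_R, bracket_E,
      bracket_T]
  leibniz_lie x y z := by
    ext1
    · simp [bracket_J]
    all_goals
      simp only [bracket_J, bracket_G, bracket_F, bracket_P, bracket_Q, bracket_R, bracket_E,
        bracket_T, so_bracket, add_G, add_F, add_P, add_Q, add_R, add_E, add_T, sub_mulVec,
        mulVec_sub, mulVec_add, mulVec_smul, ← mulVec_mulVec, add_dotProduct, dotProduct_add,
        sub_dotProduct, dotProduct_sub, smul_dotProduct, dotProduct_smul, smul_eq_mul]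
    · module
    · module
    · module
    · module
    · simp only [so_mulVec_dotProduct]
      ring
    · ring
    · simp only [so_mulVec_dotProduct]
      rw [dotProduct_comm x.F z.G, dotProduct_comm x.F y.G, dotProduct_comm z.F y.G,
        dotProduct_comm z.F x.G, dotProduct_comm y.F z.G, dotProduct_comm y.F x.G]
      ring

noncomputable instance : LieAlgebra ℝ (IHa N) where
  lie_smul c x y := by
    ext1 <;> simp [bracket_J, bracket_G, bracket_F, bracket_P, bracket_Q, bracket_R, bracket_E,
      bracket_T, mulVec_smul, smul_mulVec] <;>
      first | done | module | ring

end IHa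

/-! ### The quantum Hamilton algebra -/

/-- The underlying space of `QHa(N)`: that of `IHa(N)` with the three further components
`l, a, m` along the generators `L, A, M`. -/
structure QHa (N : ℕ) extends IHa N where
  /-- Coefficient of `L`. -/
  L : ℝ
  /-- Coefficient of `A`. -/
  A : ℝ
  /-- Coefficient of `M`. -/
  M : ℝ

namespace QHa

variable {N : ℕ}

theorem ext_toIHa {x y : QHa N} (h : x.toIHa = y.toIHa) (hL : x.L = y.L) (hA : x.A = y.A)
    (hM : x.M = y.M) : x = y := by
  cases x; cases y; simp_all

/-- The components of an element, as a tuple. -/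
def equivProd (N : ℕ) : QHa N ≃ IHa N × (ℝ × ℝ × ℝ) where
  toFun x := (x.toIHa, (x.L, x.A, x.M))
  invFun y := ⟨y.1, y.2.1, y.2.2.1, y.2.2.2⟩
  left_inv _ := rfl
  right_inv _ := rfl

/-- Componentwise addition. -/
noncomputable instance : AddCommGroup (QHa N) := (equivProd N).addCommGroup

/-- Componentwise scalar multiplication. -/
noncomputable instance : Module ℝ (QHa N) := (equivProd N).module ℝ

instance : Module.Finite ℝ (QHa N) :=
  Module.Finite.equiv (((equivProd N).linearEquiv ℝ).trans
    (((IHa.equivProd N).linearEquiv ℝ).prodCongr (LinearEquiv.refl ℝ (ℝ × ℝ × ℝ)))).symm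

@[simp] theorem add_toIHa (x y : QHa N) : (x + y).toIHa = x.toIHa + y.toIHa := rfl
@[simp] theorem add_L (x y : QHa N) : (x + y).L = x.L + y.L := rfl
@[simp] theorem add_A (x y : QHa N) : (x + y).A = x.A + y.A := rfl
@[simp] theorem add_M (x y : QHa N) : (x + y).M = x.M + y.M := rfl
@[simp] theorem zero_toIHa : (0 : QHa N).toIHa = 0 := rfl
@[simp] theorem zero_L : (0 : QHa N).L = 0 := rfl
@[simp] theorem zero_A : (0 : QHa N).A = 0 := rfl
@[simp] theorem zero_M : (0 : QHa N).M = 0 := rfl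
@[simp] theorem smul_toIHa (c : ℝ) (x : QHa N) : (c • x).toIHa = c • x.toIHa := rfl
@[simp] theorem smul_L (c : ℝ) (x : QHa N) : (c • x).L = c * x.L := rfl
@[simp] theorem smul_A (c : ℝ) (x : QHa N) : (c • x).A = c * x.A := rfl
@[simp] theorem smul_M (c : ℝ) (x : QHa N) : (c • x).M = c * x.M := rfl

/-- The brackets of the generators of `IHa(N)`, to which are added `[P_i, Q_j] = δ_i^j L`,
`[E, T] = -L`, `[F_i, Q_j] = δ_i^j A`, `[G_i, P_j] = δ_i^j M`; the generators `L, A, M` are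
central. -/
noncomputable instance : Bracket (QHa N) (QHa N) where
  bracket x y :=
    { toIHa := ⁅x.toIHa, y.toIHa⁆
      L := (x.P ⬝ᵥ y.Q - y.P ⬝ᵥ x.Q) - (x.E * y.T - y.E * x.T)
      A := x.F ⬝ᵥ y.Q - y.F ⬝ᵥ x.Q
      M := x.G ⬝ᵥ y.P - y.G ⬝ᵥ x.P }

theorem bracket_toIHa (x y : QHa N) : ⁅x, y⁆.toIHa = ⁅x.toIHa, y.toIHa⁆ := rfl
theorem bracket_L (x y : QHa N) :
    ⁅x, y⁆.L = (x.P ⬝ᵥ y.Q - y.P ⬝ᵥ x.Q) - (x.E * y.T - y.E * x.T) := rfl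
theorem bracket_A (x y : QHa N) : ⁅x, y⁆.A = x.F ⬝ᵥ y.Q - y.F ⬝ᵥ x.Q := rfl
theorem bracket_M (x y : QHa N) : ⁅x, y⁆.M = x.G ⬝ᵥ y.P - y.G ⬝ᵥ x.P := rfl

noncomputable instance : LieRing (QHa N) where
  add_lie x y z := by
    apply QHa.ext_toIHa <;> simp [bracket_toIHa, bracket_L, bracket_A, bracket_M, add_dotProduct,
      dotProduct_add] <;> ring
  lie_add x y z := by
    apply QHa.ext_toIHa <;> simp [bracket_toIHa, bracket_L, bracket_A, bracket_M, add_dotProduct,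
      dotProduct_add] <;> ring
  lie_self x := by
    apply QHa.ext_toIHa <;> simp [bracket_toIHa, bracket_L, bracket_A, bracket_M]
  leibniz_lie x y z := by
    apply QHa.ext_toIHa
    · simp [bracket_toIHa]
    all_goals
      simp only [bracket_toIHa, bracket_L, bracket_A, bracket_M, IHa.bracket_G, IHa.bracket_F,
        IHa.bracket_P, IHa.bracket_Q, IHa.bracket_E, IHa.bracket_T, add_L, add_A, add_M,
        sub_dotProduct, dotProduct_sub, add_dotProduct, dotProduct_add, smul_dotProduct,
        dotProduct_smul, smul_eq_mul, IHa.so_mulVec_dotProduct]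
    · rw [dotProduct_comm x.P z.F, dotProduct_comm x.P y.F, dotProduct_comm z.P y.F,
        dotProduct_comm z.P x.F, dotProduct_comm y.P z.F, dotProduct_comm y.P x.F]
      ring
    · rw [dotProduct_comm z.F x.F, dotProduct_comm z.F y.F, dotProduct_comm y.F x.F]
      ring
    · rw [dotProduct_comm z.G x.G, dotProduct_comm z.G y.G, dotProduct_comm y.G x.G]
      ring

noncomputable instance : LieAlgebra ℝ (QHa N) where
  lie_smul c x y := by
    apply QHa.ext_toIHa <;> simp [bracket_toIHa, bracket_L, bracket_A, bracket_M] <;> ring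

/-- The projection `QHa(N) → IHa(N)` that kills `L, A, M`. -/
noncomputable def proj (N : ℕ) : QHa N →ₗ⁅ℝ⁆ IHa N where
  toFun x := x.toIHa
  map_add' _ _ := rfl
  map_smul' _ _ := rfl
  map_lie' := rfl

/-- `QHa(N)` is a central extension of `IHa(N)`. -/
theorem proj_centralExtension (N : ℕ) :
    Function.Surjective (proj N) ∧ (proj N).ker ≤ LieAlgebra.center ℝ (QHa N) := by
  refine ⟨fun y => ⟨⟨y, 0, 0, 0⟩, rfl⟩, fun x hx y => ?_⟩
  have h : x.toIHa = 0 := hx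
  apply QHa.ext_toIHa <;> simp [bracket_toIHa, bracket_L, bracket_A, bracket_M, h]

end QHa

/-! An invariant is a function annihilated by the coadjoint vector fields, and at a point `x` these
span the row space of the commutator matrix. Independent differentials of invariants at `x`
therefore number at most `dim 𝔤 - rank`. Both the rank and the independence of analytic functions
persist from one point to a dense open set. So it is enough to exhibit `[N/2] + 4` globally analytic
invariants and one functional at which they are independent and the corank is at most `[N/2] + 4`
(`number_of_invariants`).

For the invariants, note that for each `k` the brackets of `G_k, F_k, P_k, Q_k` form the same skew
4×4 matrix with entries `R, T, L, A, M`. Its Pfaffian is `RL - MA + T²`, and the Pfaffian times its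
inverse has, up to sign, these same entries. Adding to `Pf · J` the wedges of the vector coordinates
with those coefficients gives a matrix on which all generators but the rotations act trivially,
while rotations act by commutator (`invRotDeriv_coad`). The traces of its even powers `2, 4, …,
2[N/2]`, the Pfaffian and `L, A, M` are the invariants (`invariantDeriv_coad`).

The point is `regularDual`: `T = 1`, a regular Cartan element along the rotations, and zero
elsewhere. Its stabilizer is a Cartan subalgebra of the rotations plus `T, L, A, M`
(`eq_zero_of_mem_stabilizer`). The differentials of the traces there form a Vandermonde system with
distinct nodes (`eq_zero_of_sum_invariantDeriv`). -/

/-! ### Rank of analytic families of matrices. -/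

theorem dense_ne_zero_of_analytic {E : Type*} [NormedAddCommGroup E] [NormedSpace ℝ E]
    {f : E → ℝ} (hf : ∀ x, AnalyticAt ℝ f x) {x₀ : E} (h₀ : f x₀ ≠ 0) :
    Dense {x | f x ≠ 0} := by
  rw [dense_iff_inter_open]
  intro U hU ⟨y, hy⟩
  by_contra hne
  have hz : f =ᶠ[nhds y] fun _ => 0 := by
    filter_upwards [hU.mem_nhds hy] with z hz
    by_contra hfz
    exact hne ⟨z, hz, hfz⟩
  -- Identity theorem: vanishing near one point forces vanishing everywhere.
  have := AnalyticOnNhd.eq_of_eventuallyEq (fun x _ => hf x) (fun x _ => analyticAt_const) hz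
  exact h₀ (congrFun this x₀)

namespace Matrix

theorem analyticAt_mul_apply {E l m n : Type*} [NormedAddCommGroup E] [NormedSpace ℝ E]
    [Fintype m] {A : E → Matrix l m ℝ} {B : E → Matrix m n ℝ} {x : E}
    (hA : ∀ i j, AnalyticAt ℝ (fun y => A y i j) x) (hB : ∀ i j, AnalyticAt ℝ (fun y => B y i j) x)
    (i : l) (j : n) : AnalyticAt ℝ (fun y => (A y * B y) i j) x := by
  simp only [mul_apply]
  exact Finset.analyticAt_fun_sum _ fun k _ => (hA i k).mul (hB k j)

theorem analyticAt_pow_apply {E n : Type*} [NormedAddCommGroup E] [NormedSpace ℝ E]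
    [Fintype n] [DecidableEq n] {A : E → Matrix n n ℝ} {x : E}
    (hA : ∀ i j, AnalyticAt ℝ (fun y => A y i j) x) (k : ℕ) :
    ∀ i j, AnalyticAt ℝ (fun y => (A y ^ k) i j) x := by
  induction k with
  | zero => intro i j; simpa using analyticAt_const
  | succ k ih => simpa only [pow_succ] using analyticAt_mul_apply ih hA

theorem analyticAt_det {E n : Type*} [NormedAddCommGroup E] [NormedSpace ℝ E]
    [Fintype n] [DecidableEq n] {A : E → Matrix n n ℝ} {x : E}
    (hA : ∀ i j, AnalyticAt ℝ (fun y => A y i j) x) : AnalyticAt ℝ (fun y => (A y).det) x := by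
  simp only [det_apply']
  exact Finset.analyticAt_fun_sum _ fun σ _ => analyticAt_const.mul
    (Finset.analyticAt_fun_prod _ fun i _ => hA _ _)

/-- A matrix of analytic functions that has rank at least `r` at one point has rank at least `r`
on a dense open set. -/
theorem exists_isOpen_dense_le_rank {E m n : Type*} [NormedAddCommGroup E] [NormedSpace ℝ E]
    [Fintype m] [Fintype n] {A : E → Matrix m n ℝ}
    (hA : ∀ x i j, AnalyticAt ℝ (fun y => A y i j) x) {r : ℕ} {x₀ : E} (h₀ : r ≤ (A x₀).rank) :
    ∃ S : Set E, IsOpen S ∧ Dense S ∧ ∀ x ∈ S, r ≤ (A x).rank := by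
  -- Lifting `r` independent vectors of the range gives a fixed `Q` for which `A x₀ * Q` has full
  -- column rank.
  obtain ⟨w, hw⟩ := exists_linearIndependent_of_le_finrank (R := ℝ)
    (M := LinearMap.range (A x₀).mulVecLin) (n := r) h₀
  choose q hq using fun i => (w i).2
  let Q : Matrix n (Fin r) ℝ := Matrix.of fun j i => q i j
  have hcol : (A x₀ * Q).col = fun i => (w i : m → ℝ) := by
    funext i
    rw [← hq i]
    rfl
  have hrank : (A x₀ * Q).rank = r := by
    rw [rank_eq_finrank_span_cols, hcol, finrank_span_eq_card]
    · simp
    · exact hw.map' (Submodule.subtype _) (Submodule.ker_subtype _)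
  -- The Gram determinant is one analytic function detecting full column rank of `A y * Q`; no
  -- choice of a minor is needed.
  have hf : ∀ x, AnalyticAt ℝ (fun y => ((A y * Q)ᵀ * (A y * Q)).det) x := fun x => by
    have hB : ∀ i j, AnalyticAt ℝ (fun y => (A y * Q) i j) x :=
      analyticAt_mul_apply (hA x) fun _ _ => analyticAt_const
    exact analyticAt_det (analyticAt_mul_apply (fun i j => hB j i) hB)
  refine ⟨{x | ((A x * Q)ᵀ * (A x * Q)).det ≠ 0}, ?_, dense_ne_zero_of_analytic hf (x₀ := x₀) ?_,
    fun x hx => ?_⟩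
  · exact isOpen_ne_fun (continuous_iff_continuousAt.2 fun x => (hf x).continuousAt)
      continuous_const
  · have h1 : ((A x₀ * Q)ᵀ * (A x₀ * Q)).rank = r := by rw [rank_transpose_mul_self, hrank]
    rw [← isUnit_iff_ne_zero, ← isUnit_iff_isUnit_det, ← linearIndependent_rows_iff_isUnit]
    rw [linearIndependent_iff_card_eq_finrank_span, Set.finrank, ← rank_eq_finrank_span_row, h1,
      Fintype.card_fin]
  · have h1 := rank_of_isUnit _ ((isUnit_iff_isUnit_det _).2 (isUnit_iff_ne_zero.2 hx))
    rw [rank_transpose_mul_self, Fintype.card_fin] at h1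
    exact h1.symm.le.trans (rank_mul_le_left _ _)

end Matrix

/-! ### Counting invariants by ranks. -/

namespace LieInvariants

variable {ι 𝔤 : Type*} [LieRing 𝔤] [LieAlgebra ℝ 𝔤] [Fintype ι]

/-- The linear function on `𝔤*` defined by `z`, in the coordinates of the basis `X`. -/
noncomputable def linearCoord (X : Module.Basis ι ℝ 𝔤) : 𝔤 →ₗ[ℝ] (ι → ℝ) →L[ℝ] ℝ where
  toFun z := LinearMap.toContinuousLinearMap (∑ k, X.repr z k • LinearMap.proj k)
  map_add' y z := by ext; simp [add_mul, Finset.sum_add_distrib]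
  map_smul' c z := by ext; simp [mul_assoc, Finset.mul_sum]

theorem linearCoord_apply (X : Module.Basis ι ℝ 𝔤) (z : 𝔤) (x : ι → ℝ) :
    linearCoord X z x = ∑ k, X.repr z k * x k := by
  simp [linearCoord]

theorem commutatorMatrix_apply (X : Module.Basis ι ℝ 𝔤) (x : ι → ℝ) (i j : ι) :
    commutatorMatrix X x i j = linearCoord X ⁅X i, X j⁆ x := by
  simp [commutatorMatrix, linearCoord_apply, structConst]

theorem linearCoord_commutatorMatrix (X : Module.Basis ι ℝ 𝔤) (x : ι → ℝ) (i : ι) (z : 𝔤) :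
    linearCoord X z (commutatorMatrix X x i) = linearCoord X ⁅X i, z⁆ x := by
  rw [linearCoord_apply]
  conv_rhs => rw [← X.sum_repr z]
  simp only [commutatorMatrix_apply, lie_sum, lie_smul, map_sum, map_smul,
    _root_.sum_apply, _root_.smul_apply, smul_eq_mul]

/-- The coordinates of a linear functional. -/
theorem linearCoord_dual (X : Module.Basis ι ℝ 𝔤) (ξ : 𝔤 →ₗ[ℝ] ℝ) (z : 𝔤) :
    linearCoord X z (fun k => ξ (X k)) = ξ z := by
  rw [linearCoord_apply]
  conv_rhs => rw [← X.sum_repr z]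
  simp only [map_sum, map_smul, smul_eq_mul]

theorem analyticAt_commutatorMatrix (X : Module.Basis ι ℝ 𝔤) (x : ι → ℝ) (i j : ι) :
    AnalyticAt ℝ (fun y => commutatorMatrix X y i j) x := by
  simp only [commutatorMatrix_apply]
  exact ContinuousLinearMap.analyticAt _ _

/-- The commutator matrix at `ξ` has corank at most `card κ` if `card κ` linear functions separate
the points of the stabilizer of `ξ`. -/
theorem card_le_rank_add (X : Module.Basis ι ℝ 𝔤) {κ : Type*} [Fintype κ] (ξ : 𝔤 →ₗ[ℝ] ℝ)
    (Λ : 𝔤 →ₗ[ℝ] κ → ℝ) (h : ∀ z, (∀ y : 𝔤, ξ ⁅y, z⁆ = 0) → Λ z = 0 → z = 0) :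
    Fintype.card ι ≤ (commutatorMatrix X fun k => ξ (X k)).rank + Fintype.card κ := by
  classical
  set A := commutatorMatrix X fun k => ξ (X k) with hA
  have h1 := A.mulVecLin.finrank_range_add_finrank_ker
  rw [Module.finrank_fintype_fun_eq_card] at h1
  -- The kernel of the commutator matrix is the stabilizer of `ξ` in coordinates, so injectivity of
  -- `Λ` there bounds the nullity.
  let Ψ : LinearMap.ker A.mulVecLin →ₗ[ℝ] κ → ℝ :=
    Λ ∘ₗ X.equivFun.symm.toLinearMap ∘ₗ Submodule.subtype _
  have hΨ : Function.Injective Ψ := by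
    rw [← LinearMap.ker_eq_bot, LinearMap.ker_eq_bot']
    rintro ⟨c, hc⟩ hz
    have h0 : X.equivFun.symm c = 0 := by
      refine h _ (fun y => ?_) hz
      have hXi : ∀ i, ξ ⁅X i, X.equivFun.symm c⁆ = 0 := fun i => by
        have := congrFun (LinearMap.mem_ker.1 hc) i
        simp only [mulVecLin_apply, mulVec, dotProduct, hA, commutatorMatrix_apply,
          linearCoord_dual, Pi.zero_apply] at this
        simp only [Module.Basis.equivFun_symm_apply, lie_sum, lie_smul, map_sum, map_smul,
          smul_eq_mul, ← this]
        exact Finset.sum_congr rfl fun j _ => mul_comm _ _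
      rw [← X.sum_repr y, sum_lie, map_sum]
      refine Finset.sum_eq_zero fun i _ => ?_
      rw [smul_lie, map_smul, hXi, smul_zero]
    exact Subtype.ext (X.equivFun.symm.map_eq_zero_iff.1 h0)
  have h2 := LinearMap.finrank_le_finrank_of_injective hΨ
  rw [Module.finrank_fintype_fun_eq_card] at h2
  change A.rank + _ = _ at h1
  omega

/-- The linear functional with coordinates `x`. -/
noncomputable def ofCoord (X : Module.Basis ι ℝ 𝔤) : (ι → ℝ) →ₗ[ℝ] 𝔤 →ₗ[ℝ] ℝ where
  toFun x := { toFun := fun z => linearCoord X z x, map_add' := by simp, map_smul' := by simp }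
  map_add' x y := by ext; simp
  map_smul' c x := by ext; simp

theorem ofCoord_dual (X : Module.Basis ι ℝ 𝔤) (ξ : 𝔤 →ₗ[ℝ] ℝ) :
    ofCoord X (fun k => ξ (X k)) = ξ :=
  LinearMap.ext fun z => linearCoord_dual X ξ z

/-- This identifies the direction in which `X̂_i` differentiates with a coadjoint direction, making
the invariance condition basis-free. -/
theorem ofCoord_commutatorMatrix (X : Module.Basis ι ℝ 𝔤) (x : ι → ℝ) (i : ι) :
    ofCoord X (commutatorMatrix X x i) =
      ofCoord X x ∘ₗ (LieAlgebra.ad ℝ 𝔤 (X i) : 𝔤 →ₗ[ℝ] 𝔤) :=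
  LinearMap.ext fun z => linearCoord_commutatorMatrix X x i z

theorem analyticAt_ofCoord (X : Module.Basis ι ℝ 𝔤) (z : 𝔤) (x : ι → ℝ) :
    AnalyticAt ℝ (fun y => ofCoord X y z) x :=
  ContinuousLinearMap.analyticAt (linearCoord X z) x

/-- Once analyticity is known in coordinates, differentials can be computed along lines in the dual,
so no norm on the dual is required. -/
theorem fderiv_comp_ofCoord (X : Module.Basis ι ℝ 𝔤) {Φ : (𝔤 →ₗ[ℝ] ℝ) → ℝ} {x v : ι → ℝ} {d : ℝ}
    (hΦ : AnalyticAt ℝ (fun y => Φ (ofCoord X y)) x)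
    (hd : HasDerivAt (fun s : ℝ => Φ (ofCoord X x + s • ofCoord X v)) d 0) :
    fderiv ℝ (fun y => Φ (ofCoord X y)) x v = d := by
  have h1 : HasDerivAt (fun s : ℝ => Φ (ofCoord X (x + s • v)))
      (fderiv ℝ (fun y => Φ (ofCoord X y)) x v) 0 :=
    hΦ.differentiableAt.hasFDerivAt.hasLineDerivAt v
  simp only [map_add, map_smul] at h1
  exact h1.unique hd

variable [DecidableEq ι]

theorem analyticRealization_eq (X : Module.Basis ι ℝ 𝔤) (i : ι) (F : (ι → ℝ) → ℝ) (x : ι → ℝ) :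
    analyticRealization X i F x = fderiv ℝ F x (commutatorMatrix X x i) := by
  conv_rhs => rw [pi_eq_sum_univ' (commutatorMatrix X x i)]
  simp [analyticRealization, map_sum]

/-- The matrix of the differentials of the functions `F a`. -/
noncomputable def jacobian {κ : Type*} (F : κ → (ι → ℝ) → ℝ) (x : ι → ℝ) : Matrix κ ι ℝ :=
  Matrix.of fun a j => fderiv ℝ (F a) x (Pi.single j 1)

theorem linearIndependent_fderiv_iff {κ : Type*} [Fintype κ] (F : κ → (ι → ℝ) → ℝ)
    (x : ι → ℝ) :
    LinearIndependent ℝ (fun a => fderiv ℝ (F a) x) ↔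
      Fintype.card κ ≤ (jacobian F x).rank := by
  let φ : ((ι → ℝ) →L[ℝ] ℝ) →ₗ[ℝ] (ι → ℝ) :=
    { toFun := fun f j => f (Pi.single j 1)
      map_add' := fun _ _ => rfl
      map_smul' := fun _ _ => rfl }
  have hφ : LinearMap.ker φ = ⊥ := by
    rw [LinearMap.ker_eq_bot']
    intro f hf
    apply ContinuousLinearMap.coe_injective
    refine LinearMap.pi_ext' fun j => LinearMap.ext_ring ?_
    exact congrFun hf j
  have h1 : LinearIndependent ℝ (fun a => fderiv ℝ (F a) x) ↔
      LinearIndependent ℝ (jacobian F x).row :=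
    (LinearMap.linearIndependent_iff φ hφ).symm
  rw [h1, linearIndependent_iff_card_le_finrank_span, Set.finrank, ← rank_eq_finrank_span_row]

/-- The gradients of invariants lie in the kernel of the commutator matrix, so rank and number of
independent gradients add up to at most the dimension. -/
theorem rank_add_card_le (X : Module.Basis ι ℝ 𝔤) {κ : Type*} [Fintype κ]
    {F : κ → (ι → ℝ) → ℝ} {x : ι → ℝ} (hF : ∀ a i, analyticRealization X i (F a) x = 0)
    (h : LinearIndependent ℝ fun a => fderiv ℝ (F a) x) :
    (commutatorMatrix X x).rank + Fintype.card κ ≤ Fintype.card ι := by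
  have h1 := (linearIndependent_fderiv_iff F x).1 h
  have h2 : commutatorMatrix X x * (jacobian F x)ᵀ = 0 := by
    ext i a
    exact hF a i
  have h3 := rank_add_rank_le_card_of_mul_eq_zero h2
  rw [rank_transpose] at h3
  omega

/-- Analytic invariants, independent at a point where the commutator matrix has the complementary
rank, determine the number of invariants. -/
theorem number_of_invariants (X : Module.Basis ι ℝ 𝔤) {κ : Type*} [Fintype κ]
    {F : κ → (ι → ℝ) → ℝ} (hF : ∀ a x, AnalyticAt ℝ (F a) x)
    (hinv : ∀ a i x, analyticRealization X i (F a) x = 0) {x₀ : ι → ℝ}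
    (hind : LinearIndependent ℝ fun a => fderiv ℝ (F a) x₀)
    (hrank : Fintype.card ι ≤ (commutatorMatrix X x₀).rank + Fintype.card κ) :
    invariantNumber X = Fintype.card κ ∧ ∀ U : Set (ι → ℝ), IsOpen U → U.Nonempty →
      IsMaxNumberOfInvariantsOn X U (Fintype.card κ) := by
  have hJ : ∀ x a j, AnalyticAt ℝ (fun y => jacobian F y a j) x := fun x a j =>
    AnalyticAt.comp (g := fun f : (ι → ℝ) →L[ℝ] ℝ => f (Pi.single j 1))
      ((ContinuousLinearMap.apply ℝ ℝ (Pi.single j 1 : ι → ℝ)).analyticAt _)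
      (hF a x).fderiv
  obtain ⟨S, hSo, hSd, hS⟩ := exists_isOpen_dense_le_rank hJ
    ((linearIndependent_fderiv_iff F x₀).1 hind)
  simp only [← linearIndependent_fderiv_iff] at hS
  -- The differentials may be dependent at `x` itself. The rank at `x` is still attained or exceeded
  -- on a dense open set, which meets the set `S` of independence.
  have hle : ∀ x, (commutatorMatrix X x).rank + Fintype.card κ ≤ Fintype.card ι := fun x => by
    obtain ⟨S', hSo', hSd', hS'⟩ := exists_isOpen_dense_le_rank (analyticAt_commutatorMatrix X)
      (le_refl (commutatorMatrix X x).rank)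
    obtain ⟨y, hy⟩ := (hSd.inter_of_isOpen_left hSd' hSo).nonempty
    have h1 := rank_add_card_le X (fun a i => hinv a i y) (hS y hy.1)
    have h2 := hS' y hy.2
    omega
  constructor
  · have hsup : ⨆ x : ι → ℝ, (commutatorMatrix X x).rank = (commutatorMatrix X x₀).rank := by
      refine le_antisymm (ciSup_le fun x => ?_) (le_ciSup (f := fun x => (commutatorMatrix X x).rank)
        ⟨Fintype.card ι, ?_⟩ x₀)
      · have := hle x
        omega
      · rintro _ ⟨x, rfl⟩
        exact le_trans (Nat.le_add_right _ _) (hle x)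
    rw [invariantNumber, hsup, Module.finrank_eq_card_basis X]
    have := hle x₀
    omega
  · refine fun U hU hne => ⟨?_, ?_⟩
    · let e := (Fintype.equivFin κ).symm
      refine ⟨fun b => F (e b), fun b => ⟨?_, fun i x _ => hinv _ i x⟩, ?_⟩
      · exact fun x _ => (hF (e b) x).contDiffAt.contDiffWithinAt
      · refine (hSd.open_subset_closure_inter hU).trans (closure_mono ?_)
        exact fun x hx => ⟨hx.1, (hS x hx.2).comp e e.injective⟩
    · rintro k ⟨G, hG, hGind⟩
      obtain ⟨S', hSo', hSd', hS'⟩ := exists_isOpen_dense_le_rank (analyticAt_commutatorMatrix X)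
        (le_refl (commutatorMatrix X x₀).rank)
      obtain ⟨y, hyU, hyS⟩ := hSd'.inter_open_nonempty U hU hne
      -- The functions `G` are only smooth, and independent on a set that is merely dense; openness
      -- of `S'` produces a point with both properties.
      obtain ⟨z, hz, hzU, hzi⟩ := mem_closure_iff.1 (hGind hyU) S' hSo' hyS
      have h1 := rank_add_card_le X (fun a i => (hG a).2 i z hzU) hzi
      have h2 := hS' z hz
      rw [Fintype.card_fin] at h1
      omega

end LieInvariants

/-! ### Derivatives of traces of powers, and wedges of vectors. -/

namespace Matrix

/-- `A'` is the entrywise derivative of the curve `A` at `0`. -/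
def HasEntryDeriv {m n : Type*} (A : ℝ → Matrix m n ℝ) (A' : Matrix m n ℝ) : Prop :=
  ∀ i j, HasDerivAt (fun s => A s i j) (A' i j) 0

namespace HasEntryDeriv

variable {l m n : Type*}

theorem add {A B : ℝ → Matrix m n ℝ} {A' B' : Matrix m n ℝ} (hA : HasEntryDeriv A A')
    (hB : HasEntryDeriv B B') : HasEntryDeriv (fun s => A s + B s) (A' + B') :=
  fun i j => (hA i j).fun_add (hB i j)

theorem sub {A B : ℝ → Matrix m n ℝ} {A' B' : Matrix m n ℝ} (hA : HasEntryDeriv A A')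
    (hB : HasEntryDeriv B B') : HasEntryDeriv (fun s => A s - B s) (A' - B') :=
  fun i j => (hA i j).fun_sub (hB i j)

theorem smul {c : ℝ → ℝ} {c' : ℝ} {A : ℝ → Matrix m n ℝ} {A' : Matrix m n ℝ}
    (hc : HasDerivAt c c' 0) (hA : HasEntryDeriv A A') :
    HasEntryDeriv (fun s => c s • A s) (c' • A 0 + c 0 • A') :=
  fun i j => hc.fun_mul (hA i j)

theorem mul [Fintype m] {A : ℝ → Matrix l m ℝ} {B : ℝ → Matrix m n ℝ} {A' : Matrix l m ℝ}
    {B' : Matrix m n ℝ} (hA : HasEntryDeriv A A') (hB : HasEntryDeriv B B') :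
    HasEntryDeriv (fun s => A s * B s) (A' * B 0 + A 0 * B') := fun i j => by
  simp only [mul_apply, add_apply, ← Finset.sum_add_distrib]
  exact HasDerivAt.fun_sum fun k _ => (hA i k).fun_mul (hB k j)

theorem trace [Fintype n] {A : ℝ → Matrix n n ℝ} {A' : Matrix n n ℝ} (hA : HasEntryDeriv A A') :
    HasDerivAt (fun s => (A s).trace) A'.trace 0 :=
  HasDerivAt.fun_sum fun i _ => hA i i

theorem trace_pow [Fintype n] [DecidableEq n] {A : ℝ → Matrix n n ℝ} {A' : Matrix n n ℝ}
    (hA : HasEntryDeriv A A') (k : ℕ) :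
    HasDerivAt (fun s => (A s ^ (k + 1)).trace) ((k + 1 : ℝ) * (A 0 ^ k * A').trace) 0 := by
  -- `A'` need not commute with `A 0`, so `D` itself has no short form; only its traces against
  -- powers of `A 0` do. The free exponent `p` is what the induction needs.
  have key : ∀ k : ℕ, ∃ D, HasEntryDeriv (fun s => A s ^ (k + 1)) D ∧
      ∀ p, (D * A 0 ^ p).trace = (k + 1 : ℝ) * (A 0 ^ (k + p) * A').trace := by
    intro k
    induction k with
    | zero =>
      refine ⟨A', by simpa using hA, fun p => ?_⟩
      rw [Matrix.trace_mul_comm]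
      simp
    | succ k ih =>
      obtain ⟨D, hD, hp⟩ := ih
      refine ⟨_, by simpa only [pow_succ _ (k + 1)] using hD.mul hA, fun p => ?_⟩
      rw [Matrix.add_mul, Matrix.trace_add, Matrix.mul_assoc, ← pow_succ', hp, Matrix.mul_assoc,
        Matrix.trace_mul_comm (A 0 ^ (k + 1)) (A' * _), Matrix.mul_assoc, ← pow_add,
        Matrix.trace_mul_comm A', show p + (k + 1) = k + 1 + p by ring,
        show k + (p + 1) = k + 1 + p by ring]
      push_cast
      ring
  obtain ⟨D, hD, hp⟩ := key k
  refine hD.trace.congr_deriv ?_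
  simpa using hp 0

end HasEntryDeriv

/-- The matrix `u vᵀ - v uᵀ` of `u ∧ v`. -/
def wedge {n : Type*} (u v : n → ℝ) : Matrix n n ℝ :=
  of fun i k => u i * v k - u k * v i

theorem wedge_apply {n : Type*} (u v : n → ℝ) (i k : n) :
    wedge u v i k = u i * v k - u k * v i := rfl

theorem wedge_zero_left {n : Type*} (v : n → ℝ) : wedge 0 v = 0 := by
  ext; simp [wedge_apply]

theorem HasEntryDeriv.wedge {n : Type*} {u v : ℝ → n → ℝ} {u' v' : n → ℝ}
    (hu : ∀ i, HasDerivAt (fun s => u s i) (u' i) 0)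
    (hv : ∀ i, HasDerivAt (fun s => v s i) (v' i) 0) :
    HasEntryDeriv (fun s => wedge (u s) (v s)) (Matrix.wedge u' (v 0) + Matrix.wedge (u 0) v') :=
  fun i k => (((hu i).fun_mul (hv k)).fun_sub ((hu k).fun_mul (hv i))).congr_deriv (by
    simp only [add_apply, wedge_apply]
    ring)

/-- For skew `Y` the commutator is the infinitesimal rotation of `u ∧ v`, which acts as a
derivation. -/
theorem wedge_mul_sub_mul_wedge {n : Type*} [Fintype n] {Y : Matrix n n ℝ} (hY : Yᵀ = -Y)
    (u v : n → ℝ) :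
    Matrix.wedge u v * Y - Y * Matrix.wedge u v =
      -(Matrix.wedge (Y *ᵥ u) v + Matrix.wedge u (Y *ᵥ v)) := by
  have hY' : ∀ i k, Y i k = -Y k i := fun i k => congrFun (congrFun hY k) i
  ext i k
  simp only [sub_apply, mul_apply, wedge_apply, neg_apply, add_apply, mulVec, dotProduct,
    Finset.mul_sum, Finset.sum_mul, ← Finset.sum_sub_distrib, ← Finset.sum_add_distrib,
    ← Finset.sum_neg_distrib]
  refine Finset.sum_congr rfl fun x _ => ?_
  rw [hY' x k]
  ring

end Matrix

/-! ### Generators of `QHa N` and their brackets with an arbitrary element. -/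

namespace QHa

variable {N : ℕ}

/-- The rotation generator `J_{ik}`. -/
def rot (i k : Fin N) : LieAlgebra.Orthogonal.so (Fin N) ℝ :=
  ⟨single i k 1 - single k i 1, by
    rw [LieAlgebra.Orthogonal.mem_so]
    simp [transpose_sub]⟩

/-- The element of `QHa N` with given components. -/
def mk' (J : LieAlgebra.Orthogonal.so (Fin N) ℝ) (G F P Q : Fin N → ℝ) (R E T L A M : ℝ) : QHa N :=
  { J := J, G := G, F := F, P := P, Q := Q, R := R, E := E, T := T, L := L, A := A, M := M }

theorem lie_eq (x y : QHa N) : ⁅x, y⁆ = mk' ⁅x.J, y.J⁆ (x.J.1 *ᵥ y.G - y.J.1 *ᵥ x.G)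
    (x.J.1 *ᵥ y.F - y.J.1 *ᵥ x.F) (x.J.1 *ᵥ y.P - y.J.1 *ᵥ x.P - (x.E • y.G - y.E • x.G))
    (x.J.1 *ᵥ y.Q - y.J.1 *ᵥ x.Q + (x.E • y.F - y.E • x.F)) (x.G ⬝ᵥ y.F - y.G ⬝ᵥ x.F) 0
    ((x.G ⬝ᵥ y.Q - y.G ⬝ᵥ x.Q) + (x.F ⬝ᵥ y.P - y.F ⬝ᵥ x.P) + 2 * (x.E * y.R - y.E * x.R))
    ((x.P ⬝ᵥ y.Q - y.P ⬝ᵥ x.Q) - (x.E * y.T - y.E * x.T)) (x.F ⬝ᵥ y.Q - y.F ⬝ᵥ x.Q)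
    (x.G ⬝ᵥ y.P - y.G ⬝ᵥ x.P) := rfl

theorem ext_components {x y : QHa N} (hJ : x.J = y.J) (hG : x.G = y.G) (hF : x.F = y.F)
    (hP : x.P = y.P) (hQ : x.Q = y.Q) (hR : x.R = y.R) (hE : x.E = y.E) (hT : x.T = y.T)
    (hL : x.L = y.L) (hA : x.A = y.A) (hM : x.M = y.M) : x = y :=
  ext_toIHa (IHa.ext hJ hG hF hP hQ hR hE hT) hL hA hM

theorem transpose_J (y : QHa N) : (y.J.1)ᵀ = -y.J.1 :=
  (LieAlgebra.Orthogonal.mem_so (Fin N) ℝ _).1 y.J.2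

/-- The embedding of the rotations. -/
def genJ : LieAlgebra.Orthogonal.so (Fin N) ℝ →ₗ[ℝ] QHa N where
  toFun B := mk' B 0 0 0 0 0 0 0 0 0 0
  map_add' _ _ := by apply ext_components <;> simp [mk']
  map_smul' _ _ := by apply ext_components <;> simp [mk']

/-- The vectors `∑ k, u_k G_k`. -/
def genG : (Fin N → ℝ) →ₗ[ℝ] QHa N where
  toFun u := mk' 0 u 0 0 0 0 0 0 0 0 0
  map_add' _ _ := by apply ext_components <;> simp [mk']
  map_smul' _ _ := by apply ext_components <;> simp [mk']

/-- The vectors `∑ k, u_k F_k`. -/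
def genF : (Fin N → ℝ) →ₗ[ℝ] QHa N where
  toFun u := mk' 0 0 u 0 0 0 0 0 0 0 0
  map_add' _ _ := by apply ext_components <;> simp [mk']
  map_smul' _ _ := by apply ext_components <;> simp [mk']

/-- The vectors `∑ k, u_k P_k`. -/
def genP : (Fin N → ℝ) →ₗ[ℝ] QHa N where
  toFun u := mk' 0 0 0 u 0 0 0 0 0 0 0
  map_add' _ _ := by apply ext_components <;> simp [mk']
  map_smul' _ _ := by apply ext_components <;> simp [mk']

/-- The vectors `∑ k, u_k Q_k`. -/
def genQ : (Fin N → ℝ) →ₗ[ℝ] QHa N where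
  toFun u := mk' 0 0 0 0 u 0 0 0 0 0 0
  map_add' _ _ := by apply ext_components <;> simp [mk']
  map_smul' _ _ := by apply ext_components <;> simp [mk']

/-- The generator `R`. -/
def genR : QHa N := mk' 0 0 0 0 0 1 0 0 0 0 0
/-- The generator `E`. -/
def genE : QHa N := mk' 0 0 0 0 0 0 1 0 0 0 0
/-- The generator `T`. -/
def genT : QHa N := mk' 0 0 0 0 0 0 0 1 0 0 0
/-- The generator `L`. -/
def genL : QHa N := mk' 0 0 0 0 0 0 0 0 1 0 0
/-- The generator `A`. -/
def genA : QHa N := mk' 0 0 0 0 0 0 0 0 0 1 0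
/-- The generator `M`. -/
def genM : QHa N := mk' 0 0 0 0 0 0 0 0 0 0 1

variable (y : QHa N)

theorem lie_genJ (B : LieAlgebra.Orthogonal.so (Fin N) ℝ) :
    ⁅y, genJ B⁆ = genJ ⁅y.J, B⁆ - genG (B.1 *ᵥ y.G) - genF (B.1 *ᵥ y.F) - genP (B.1 *ᵥ y.P)
      - genQ (B.1 *ᵥ y.Q) := by
  simp only [sub_eq_add_neg, ← map_neg]
  apply ext_components <;>
    simp [genJ, genG, genF, genP, genQ, mk', lie_eq, -neg_smul]

theorem lie_genG (u : Fin N → ℝ) :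
    ⁅y, genG u⁆ = genG (y.J.1 *ᵥ u) + (-y.E) • genP u + (-(u ⬝ᵥ y.F)) • genR
      + (-(u ⬝ᵥ y.Q)) • genT + (-(u ⬝ᵥ y.P)) • genM := by
  apply ext_components <;>
    simp [genG, genP, genR, genT, genM, mk', lie_eq, -neg_smul]
  exact (neg_smul _ _).symm

theorem lie_genF (u : Fin N → ℝ) :
    ⁅y, genF u⁆ = genF (y.J.1 *ᵥ u) + y.E • genQ u + (u ⬝ᵥ y.G) • genR
      + (-(u ⬝ᵥ y.P)) • genT + (-(u ⬝ᵥ y.Q)) • genA := by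
  apply ext_components <;>
    simp [genF, genQ, genR, genT, genA, mk', lie_eq, -neg_smul, dotProduct_comm u]

theorem lie_genP (u : Fin N → ℝ) :
    ⁅y, genP u⁆ = genP (y.J.1 *ᵥ u) + (u ⬝ᵥ y.F) • genT + (-(u ⬝ᵥ y.Q)) • genL
      + (u ⬝ᵥ y.G) • genM := by
  apply ext_components <;>
    simp [genP, genL, genT, genM, mk', lie_eq, -neg_smul, dotProduct_comm u]

theorem lie_genQ (u : Fin N → ℝ) :
    ⁅y, genQ u⁆ = genQ (y.J.1 *ᵥ u) + (u ⬝ᵥ y.G) • genT + (u ⬝ᵥ y.P) • genL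
      + (u ⬝ᵥ y.F) • genA := by
  apply ext_components <;>
    simp [genQ, genL, genT, genA, mk', lie_eq, -neg_smul, dotProduct_comm u]

theorem lie_genR : ⁅y, (genR : QHa N)⁆ = (2 * y.E) • genT := by
  apply ext_components <;>
    simp [genR, genT, mk', lie_eq, -neg_smul]

theorem lie_genT : ⁅y, (genT : QHa N)⁆ = (-y.E) • genL := by
  apply ext_components <;>
    simp [genT, genL, mk', lie_eq, -neg_smul]

theorem lie_genL : ⁅y, (genL : QHa N)⁆ = 0 := by
  apply ext_components <;>
    simp [genL, mk', lie_eq, -neg_smul]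

theorem lie_genA : ⁅y, (genA : QHa N)⁆ = 0 := by
  apply ext_components <;>
    simp [genA, mk', lie_eq, -neg_smul]

theorem lie_genM : ⁅y, (genM : QHa N)⁆ = 0 := by
  apply ext_components <;>
    simp [genM, mk', lie_eq, -neg_smul]

end QHa

/-! ### Coordinates on the dual and the corrected rotations. -/

namespace QHa

variable {N : ℕ}

section Coordinates

variable (ξ η : QHa N →ₗ[ℝ] ℝ)

/-- The coordinates of a functional along the rotations. -/
noncomputable def coordJ : Matrix (Fin N) (Fin N) ℝ := of fun i k => ξ (genJ (rot i k))
/-- The coordinates of a functional along the `G_k`. -/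
noncomputable def coordG : Fin N → ℝ := fun k => ξ (genG (Pi.single k 1))
/-- The coordinates of a functional along the `F_k`. -/
noncomputable def coordF : Fin N → ℝ := fun k => ξ (genF (Pi.single k 1))
/-- The coordinates of a functional along the `P_k`. -/
noncomputable def coordP : Fin N → ℝ := fun k => ξ (genP (Pi.single k 1))
/-- The coordinates of a functional along the `Q_k`. -/
noncomputable def coordQ : Fin N → ℝ := fun k => ξ (genQ (Pi.single k 1))

/-- The Pfaffian of the commutator form on the span of the vector generators. -/
noncomputable def pfaffian : ℝ := ξ genR * ξ genL - ξ genM * ξ genA + ξ genT ^ 2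

/-- The rotation generators, multiplied by the Pfaffian and corrected so as to commute with all
generators but the rotations. -/
noncomputable def invRot : Matrix (Fin N) (Fin N) ℝ :=
  pfaffian ξ • coordJ ξ + ξ genL • wedge (coordG ξ) (coordF ξ)
    - ξ genA • wedge (coordG ξ) (coordP ξ) + ξ genT • wedge (coordG ξ) (coordQ ξ)
    + ξ genT • wedge (coordF ξ) (coordP ξ) - ξ genM • wedge (coordF ξ) (coordQ ξ)
    + ξ genR • wedge (coordP ξ) (coordQ ξ)

/-- The derivative of `pfaffian` at `ξ` in the direction of `η`. -/
noncomputable def pfaffianDeriv : ℝ :=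
  η genR * ξ genL + ξ genR * η genL - (η genM * ξ genA + ξ genM * η genA) + 2 * ξ genT * η genT

/-- The derivative of `invRot` at `ξ` in the direction of `η`. -/
noncomputable def invRotDeriv : Matrix (Fin N) (Fin N) ℝ :=
  (pfaffianDeriv ξ η • coordJ ξ + pfaffian ξ • coordJ η)
    + (η genL • wedge (coordG ξ) (coordF ξ)
      + ξ genL • (wedge (coordG η) (coordF ξ) + wedge (coordG ξ) (coordF η)))
    - (η genA • wedge (coordG ξ) (coordP ξ)
      + ξ genA • (wedge (coordG η) (coordP ξ) + wedge (coordG ξ) (coordP η)))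
    + (η genT • wedge (coordG ξ) (coordQ ξ)
      + ξ genT • (wedge (coordG η) (coordQ ξ) + wedge (coordG ξ) (coordQ η)))
    + (η genT • wedge (coordF ξ) (coordP ξ)
      + ξ genT • (wedge (coordF η) (coordP ξ) + wedge (coordF ξ) (coordP η)))
    - (η genM • wedge (coordF ξ) (coordQ ξ)
      + ξ genM • (wedge (coordF η) (coordQ ξ) + wedge (coordF ξ) (coordQ η)))
    + (η genR • wedge (coordP ξ) (coordQ ξ)
      + ξ genR • (wedge (coordP η) (coordQ ξ) + wedge (coordP ξ) (coordQ η)))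

theorem hasDerivAt_line (z : QHa N) : HasDerivAt (fun s : ℝ => (ξ + s • η) z) (η z) 0 := by
  simpa using ((hasDerivAt_id (0 : ℝ)).mul_const (η z)).const_add (ξ z)

theorem hasDerivAt_pfaffian :
    HasDerivAt (fun s : ℝ => pfaffian (ξ + s • η)) (pfaffianDeriv ξ η) 0 := by
  have h := hasDerivAt_line ξ η
  refine ((((h genR).fun_mul (h genL)).fun_sub ((h genM).fun_mul (h genA))).fun_add
    ((h genT).fun_pow 2)).congr_deriv ?_
  simp [pfaffianDeriv]

theorem hasEntryDeriv_invRot :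
    HasEntryDeriv (fun s : ℝ => invRot (ξ + s • η)) (invRotDeriv ξ η) := by
  have h := hasDerivAt_line ξ η
  have hG : ∀ k, HasDerivAt (fun s : ℝ => coordG (ξ + s • η) k) (coordG η k) 0 := fun k => h _
  have hF : ∀ k, HasDerivAt (fun s : ℝ => coordF (ξ + s • η) k) (coordF η k) 0 := fun k => h _
  have hP : ∀ k, HasDerivAt (fun s : ℝ => coordP (ξ + s • η) k) (coordP η k) 0 := fun k => h _
  have hQ : ∀ k, HasDerivAt (fun s : ℝ => coordQ (ξ + s • η) k) (coordQ η k) 0 := fun k => h _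
  have hJ : HasEntryDeriv (fun s : ℝ => coordJ (ξ + s • η)) (coordJ η) := fun i k => h _
  have := ((((((HasEntryDeriv.smul (hasDerivAt_pfaffian ξ η) hJ).add
    (.smul (h genL) (.wedge hG hF))).sub (.smul (h genA) (.wedge hG hP))).add
    (.smul (h genT) (.wedge hG hQ))).add (.smul (h genT) (.wedge hF hP))).sub
    (.smul (h genM) (.wedge hF hQ))).add (.smul (h genR) (.wedge hP hQ))
  simp only [zero_smul, add_zero] at this
  exact this

theorem apply_genG (u : Fin N → ℝ) : ξ (genG u) = u ⬝ᵥ coordG ξ := by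
  conv_lhs => rw [pi_eq_sum_univ' u]
  simp [dotProduct, coordG]

theorem apply_genF (u : Fin N → ℝ) : ξ (genF u) = u ⬝ᵥ coordF ξ := by
  conv_lhs => rw [pi_eq_sum_univ' u]
  simp [dotProduct, coordF]

theorem apply_genP (u : Fin N → ℝ) : ξ (genP u) = u ⬝ᵥ coordP ξ := by
  conv_lhs => rw [pi_eq_sum_univ' u]
  simp [dotProduct, coordP]

theorem apply_genQ (u : Fin N → ℝ) : ξ (genQ u) = u ⬝ᵥ coordQ ξ := by
  conv_lhs => rw [pi_eq_sum_univ' u]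
  simp [dotProduct, coordQ]

theorem coordJ_swap (i k : Fin N) : coordJ ξ k i = -coordJ ξ i k := by
  have : rot k i = -rot i k := Subtype.ext (by simp [rot])
  simp [coordJ, this]

/-- The coordinates along rotations represent the functional through the trace form; the factor
`1/2` appears because summing over all `(i, k)` counts each `J_{ik}` twice. -/
theorem apply_genJ (B : LieAlgebra.Orthogonal.so (Fin N) ℝ) :
    ξ (genJ B) = -(B.1 * coordJ ξ).trace / 2 := by
  have hskew : ∀ i k, B.1 k i = -B.1 i k := fun i k =>
    congrFun (congrFun ((LieAlgebra.Orthogonal.mem_so (Fin N) ℝ _).1 B.2) i) k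
  have hB : (2 : ℝ) • B = ∑ i, ∑ k, B.1 i k • rot i k := by
    apply Subtype.ext
    have h1 : ∑ i, ∑ k, B.1 i k • single k i (1 : ℝ) = -B.1 := by
      conv_rhs => rw [matrix_eq_sum_single B.1]
      rw [Finset.sum_comm, ← Finset.sum_neg_distrib]
      refine Finset.sum_congr rfl fun i _ => ?_
      rw [← Finset.sum_neg_distrib]
      refine Finset.sum_congr rfl fun k _ => ?_
      rw [hskew, smul_single, smul_eq_mul, mul_one, single_neg]
    have h2 : ∑ i, ∑ k, B.1 i k • single i k (1 : ℝ) = B.1 := by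
      conv_rhs => rw [matrix_eq_sum_single B.1]
      simp
    simp only [rot, AddSubmonoidClass.coe_finsetSum, SetLike.val_smul, smul_sub, Finset.sum_sub_distrib, h1, h2]
    module
  have h3 : 2 * ξ (genJ B) = ∑ i, ∑ k, B.1 i k * coordJ ξ i k := by
    rw [← smul_eq_mul, ← map_smul, ← map_smul, hB]
    simp [coordJ]
  have h4 : (B.1 * coordJ ξ).trace = -∑ i, ∑ k, B.1 i k * coordJ ξ i k := by
    simp only [trace, diag, mul_apply, ← Finset.sum_neg_distrib]
    refine Finset.sum_congr rfl fun i _ => Finset.sum_congr rfl fun k _ => ?_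
    rw [coordJ_swap]
    ring
  rw [h4, ← h3]
  ring

end Coordinates

/-! ### The coadjoint action in coordinates. -/

section Coadjoint

variable (ξ : QHa N →ₗ[ℝ] ℝ) (y : QHa N)

/-- The image of `ξ` under the coadjoint action of `y`, up to sign. -/
noncomputable def coad : QHa N →ₗ[ℝ] ℝ := ξ ∘ₗ (LieAlgebra.ad ℝ (QHa N) y : QHa N →ₗ[ℝ] QHa N)

theorem coad_apply (z : QHa N) : coad ξ y z = ξ ⁅y, z⁆ := rfl

theorem mulVec_single_dotProduct (u : Fin N → ℝ) (k : Fin N) :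
    (y.J.1 *ᵥ Pi.single k 1) ⬝ᵥ u = -(y.J.1 *ᵥ u) k := by
  rw [IHa.so_mulVec_dotProduct]
  simp

theorem coordG_coad : coordG (coad ξ y) = -(y.J.1 *ᵥ coordG ξ) - y.E • coordP ξ
    - ξ genR • y.F - ξ genT • y.Q - ξ genM • y.P := by
  ext k
  change ξ ⁅y, genG (Pi.single k 1)⁆ = _
  simp only [lie_genG, map_add, map_smul, apply_genG, apply_genP,
    mulVec_single_dotProduct]
  simp
  ring

theorem coordF_coad : coordF (coad ξ y) = -(y.J.1 *ᵥ coordF ξ) + y.E • coordQ ξ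
    + ξ genR • y.G - ξ genT • y.P - ξ genA • y.Q := by
  ext k
  change ξ ⁅y, genF (Pi.single k 1)⁆ = _
  simp only [lie_genF, map_add, map_smul, apply_genF, apply_genQ,
    mulVec_single_dotProduct]
  simp
  ring

theorem coordP_coad : coordP (coad ξ y) = -(y.J.1 *ᵥ coordP ξ)
    + ξ genT • y.F - ξ genL • y.Q + ξ genM • y.G := by
  ext k
  change ξ ⁅y, genP (Pi.single k 1)⁆ = _
  simp only [lie_genP, map_add, map_smul, apply_genP,
    mulVec_single_dotProduct]
  simp
  ring

theorem coordQ_coad : coordQ (coad ξ y) = -(y.J.1 *ᵥ coordQ ξ)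
    + ξ genT • y.G + ξ genL • y.P + ξ genA • y.F := by
  ext k
  change ξ ⁅y, genQ (Pi.single k 1)⁆ = _
  simp only [lie_genQ, map_add, map_smul, apply_genQ,
    mulVec_single_dotProduct]
  simp
  ring

theorem trace_rot_mul (A : Matrix (Fin N) (Fin N) ℝ) (i k : Fin N) :
    ((rot i k).1 * A).trace = A k i - A i k := by
  simp [rot, sub_mul, trace_sub, trace_single_mul]

theorem rot_mulVec_dotProduct (u v : Fin N → ℝ) (i k : Fin N) :
    ((rot i k).1 *ᵥ u) ⬝ᵥ v = wedge v u i k := by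
  simp [rot, sub_mulVec, single_mulVec, wedge_apply, mul_comm, Function.update, dotProduct, mul_sub]

theorem coordJ_coad : coordJ (coad ξ y) = coordJ ξ * y.J.1 - y.J.1 * coordJ ξ
    - wedge (coordG ξ) y.G - wedge (coordF ξ) y.F - wedge (coordP ξ) y.P
    - wedge (coordQ ξ) y.Q := by
  have hj : (coordJ ξ)ᵀ = -coordJ ξ := by
    ext i k
    exact coordJ_swap ξ i k
  have hc : (coordJ ξ * y.J.1 - y.J.1 * coordJ ξ)ᵀ = -(coordJ ξ * y.J.1 - y.J.1 * coordJ ξ) := by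
    rw [transpose_sub, transpose_mul, transpose_mul, hj, transpose_J]
    noncomm_ring
  ext i k
  -- Pairing with `rot i k` yields the difference of two opposite entries of the commutator;
  -- skewness makes it twice one entry, cancelling the `1/2` of `apply_genJ`.
  have h1 := congrFun (congrFun hc i) k
  have h2 : (⁅y.J, rot i k⁆ : LieAlgebra.Orthogonal.so (Fin N) ℝ).1 * coordJ ξ
      = y.J.1 * (rot i k).1 * coordJ ξ - (rot i k).1 * (y.J.1 * coordJ ξ) := by
    rw [IHa.so_bracket]
    noncomm_ring
  have h3 : (y.J.1 * (rot i k).1 * coordJ ξ).trace = ((rot i k).1 * (coordJ ξ * y.J.1)).trace := by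
    rw [mul_assoc, trace_mul_comm, mul_assoc]
  simp only [transpose_apply, Matrix.sub_apply, Matrix.neg_apply] at h1
  change ξ ⁅y, genJ (rot i k)⁆ = _
  simp only [lie_genJ, map_sub, apply_genG, apply_genF, apply_genP, apply_genQ,
    rot_mulVec_dotProduct, apply_genJ, h2, trace_sub, h3, trace_rot_mul, Matrix.sub_apply]
  linarith

/-- Only `E` moves `R` and `T`, and its contributions `2TL` from `RL` and `-2TL` from `T²` cancel.
-/
theorem pfaffianDeriv_coad : pfaffianDeriv ξ (coad ξ y) = 0 := by
  simp [pfaffianDeriv, coad_apply, lie_genR, lie_genL, lie_genM, lie_genA, lie_genT]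
  ring

/-- The vector generators change `Pf · J` by wedges that cancel the change of the correction terms,
whose coefficients are the Pfaffian times the inverse of the commutator form. The contributions of
`E` cancel among the correction terms themselves. What remains is the rotation part, acting by
commutator. -/
theorem invRotDeriv_coad :
    invRotDeriv ξ (coad ξ y) = invRot ξ * y.J.1 - y.J.1 * invRot ξ := by
  have hw := wedge_mul_sub_mul_wedge (transpose_J y)
  have h1 : invRot ξ * y.J.1 - y.J.1 * invRot ξ =
      pfaffian ξ • (coordJ ξ * y.J.1 - y.J.1 * coordJ ξ)
      + ξ genL • (wedge (coordG ξ) (coordF ξ) * y.J.1 - y.J.1 * wedge (coordG ξ) (coordF ξ))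
      - ξ genA • (wedge (coordG ξ) (coordP ξ) * y.J.1 - y.J.1 * wedge (coordG ξ) (coordP ξ))
      + ξ genT • (wedge (coordG ξ) (coordQ ξ) * y.J.1 - y.J.1 * wedge (coordG ξ) (coordQ ξ))
      + ξ genT • (wedge (coordF ξ) (coordP ξ) * y.J.1 - y.J.1 * wedge (coordF ξ) (coordP ξ))
      - ξ genM • (wedge (coordF ξ) (coordQ ξ) * y.J.1 - y.J.1 * wedge (coordF ξ) (coordQ ξ))
      + ξ genR • (wedge (coordP ξ) (coordQ ξ) * y.J.1 - y.J.1 * wedge (coordP ξ) (coordQ ξ)) := by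
    simp only [invRot, add_mul, sub_mul, mul_add, mul_sub, smul_mul_assoc, mul_smul_comm]
    module
  have hR : coad ξ y genR = 2 * y.E * ξ genT := by simp [coad_apply, lie_genR]
  have hT : coad ξ y genT = -y.E * ξ genL := by simp [coad_apply, lie_genT]
  have hL : coad ξ y genL = 0 := by simp [coad_apply, lie_genL]
  have hA : coad ξ y genA = 0 := by simp [coad_apply, lie_genA]
  have hM : coad ξ y genM = 0 := by simp [coad_apply, lie_genM]
  rw [h1, invRotDeriv, pfaffianDeriv_coad, coordJ_coad, coordG_coad, coordF_coad, coordP_coad,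
    coordQ_coad, hR, hT, hL, hA, hM]
  simp only [hw]
  ext i k
  simp only [Matrix.add_apply, Matrix.sub_apply, Matrix.smul_apply, Matrix.neg_apply, wedge_apply, Pi.add_apply, Pi.sub_apply,
    Pi.neg_apply, Pi.smul_apply, smul_eq_mul, pfaffian]
  ring

end Coadjoint

/-! ### The invariants and their derivatives. -/

/-- The invariants of `QHa N`: traces of powers of `invRot`, the Pfaffian and the central
generators. -/
noncomputable def invariant (N : ℕ) : Fin (N / 2) ⊕ Fin 4 → (QHa N →ₗ[ℝ] ℝ) → ℝ :=
  Sum.elim (fun k ξ => (invRot ξ ^ (2 * (k : ℕ) + 1 + 1)).trace)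
    ![pfaffian, fun ξ => ξ genL, fun ξ => ξ genA, fun ξ => ξ genM]

/-- The derivatives of the invariants at `ξ` in the direction of `η`. -/
noncomputable def invariantDeriv (ξ η : QHa N →ₗ[ℝ] ℝ) : Fin (N / 2) ⊕ Fin 4 → ℝ :=
  Sum.elim (fun k => ((2 * (k : ℕ) + 1 : ℕ) + 1 : ℝ) *
      (invRot ξ ^ (2 * (k : ℕ) + 1) * invRotDeriv ξ η).trace)
    ![pfaffianDeriv ξ η, η genL, η genA, η genM]

theorem hasDerivAt_invariant (ξ η : QHa N →ₗ[ℝ] ℝ) (a : Fin (N / 2) ⊕ Fin 4) :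
    HasDerivAt (fun s : ℝ => invariant N a (ξ + s • η)) (invariantDeriv ξ η a) 0 := by
  rcases a with k | a
  · have := (hasEntryDeriv_invRot ξ η).trace_pow (2 * (k : ℕ) + 1)
    simp only [zero_smul, add_zero] at this
    exact this
  · fin_cases a
    · exact hasDerivAt_pfaffian ξ η
    · exact hasDerivAt_line ξ η genL
    · exact hasDerivAt_line ξ η genA
    · exact hasDerivAt_line ξ η genM

/-- For the traces this is cyclicity: a power of a matrix `W` times a commutator of `W` has trace
zero. -/
theorem invariantDeriv_coad (ξ : QHa N →ₗ[ℝ] ℝ) (y : QHa N) (a : Fin (N / 2) ⊕ Fin 4) :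
    invariantDeriv ξ (coad ξ y) a = 0 := by
  rcases a with k | a
  · simp only [invariantDeriv, Sum.elim_inl, invRotDeriv_coad, mul_sub, trace_sub]
    rw [← mul_assoc, ← pow_succ, ← mul_assoc, trace_mul_comm _ (invRot ξ), ← mul_assoc,
      ← pow_succ', sub_self]
  · fin_cases a
    · exact pfaffianDeriv_coad ξ y
    all_goals simp [invariantDeriv, coad_apply, lie_genL, lie_genA, lie_genM]

theorem analyticAt_invariant {E : Type*} [NormedAddCommGroup E] [NormedSpace ℝ E]
    {ξ : E → QHa N →ₗ[ℝ] ℝ} {x : E} (h : ∀ z, AnalyticAt ℝ (fun y => ξ y z) x)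
    (a : Fin (N / 2) ⊕ Fin 4) : AnalyticAt ℝ (fun y => invariant N a (ξ y)) x := by
  have hp : AnalyticAt ℝ (fun y => pfaffian (ξ y)) x :=
    (((h genR).fun_mul (h genL)).fun_sub ((h genM).fun_mul (h genA))).fun_add ((h genT).fun_pow 2)
  rcases a with k | a
  · have hW : ∀ i j, AnalyticAt ℝ (fun y => invRot (ξ y) i j) x := fun i j => by
      have hw : ∀ {c : E → ℝ} {u v : E → Fin N → ℝ}, AnalyticAt ℝ c x →
          (∀ i, AnalyticAt ℝ (fun y => u y i) x) → (∀ i, AnalyticAt ℝ (fun y => v y i) x) →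
          AnalyticAt ℝ (fun y => (c y • wedge (u y) (v y)) i j) x := fun hc hu hv =>
        hc.fun_mul (((hu i).fun_mul (hv j)).fun_sub ((hu j).fun_mul (hv i)))
      have hG : ∀ k, AnalyticAt ℝ (fun y => coordG (ξ y) k) x := fun k => h _
      have hF : ∀ k, AnalyticAt ℝ (fun y => coordF (ξ y) k) x := fun k => h _
      have hP : ∀ k, AnalyticAt ℝ (fun y => coordP (ξ y) k) x := fun k => h _
      have hQ : ∀ k, AnalyticAt ℝ (fun y => coordQ (ξ y) k) x := fun k => h _
      exact ((((((hp.fun_mul (h (genJ (rot i j)))).fun_add (hw (h _) hG hF)).fun_sub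
        (hw (h _) hG hP)).fun_add (hw (h _) hG hQ)).fun_add (hw (h _) hF hP)).fun_sub
        (hw (h _) hF hQ)).fun_add (hw (h _) hP hQ)
    exact Finset.analyticAt_fun_sum Finset.univ fun i _ =>
      analyticAt_pow_apply hW (2 * (k : ℕ) + 1 + 1) i i
  · fin_cases a
    · exact hp
    · exact h genL
    · exact h genA
    · exact h genM

end QHa

/-! ### The regular functional: its stabilizer and the Jacobian there. -/

namespace QHa

variable {N : ℕ}

/-- A regular element of a Cartan subalgebra of `so N`: block diagonal, with blocks that are
multiples of the rotation through a right angle by `1, 2, …`. -/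
noncomputable def regularRot (N : ℕ) : Matrix (Fin N) (Fin N) ℝ :=
  of fun i k => if (k : ℕ) = i + 1 ∧ (i : ℕ) % 2 = 0 then (((i : ℕ) / 2 : ℕ) : ℝ) + 1
    else if (i : ℕ) = k + 1 ∧ (k : ℕ) % 2 = 0 then -((((k : ℕ) / 2 : ℕ) : ℝ) + 1) else 0

/-- The diagonal of the square of `regularRot`. -/
noncomputable def regularRotSq (i : Fin N) : ℝ :=
  if (i : ℕ) / 2 < N / 2 then -((((i : ℕ) / 2 : ℕ) : ℝ) + 1) ^ 2 else 0

theorem transpose_regularRot : (regularRot N)ᵀ = -regularRot N := by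
  ext i k
  simp only [regularRot, transpose_apply, of_apply, Matrix.neg_apply]
  split_ifs <;> first | omega | simp

theorem regularRot_swap (i k : Fin N) : regularRot N k i = -regularRot N i k :=
  congrFun (congrFun transpose_regularRot i) k

/-- Each row of `regularRot` has at most one nonzero entry, at the partner index in its block; the
last index has no partner when `N` is odd. -/
theorem regularRot_mul_self : regularRot N * regularRot N = diagonal regularRotSq := by
  ext i k
  rw [mul_apply, diagonal_apply]
  rcases Nat.mod_two_eq_zero_or_one i with hi | hi
  · by_cases hN : (i : ℕ) + 1 < N
    · rw [Finset.sum_eq_single ⟨i + 1, hN⟩]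
      · have h1 : ((i : ℕ) + 1) / 2 = (i : ℕ) / 2 := by omega
        have h2 : (i : ℕ) / 2 < N / 2 := by omega
        simp only [regularRot, of_apply, regularRotSq, Fin.ext_iff, h2, true_and, hi, if_true]
        by_cases hik : (i : ℕ) = k
        · have h3 : ¬ ((k : ℕ) = i + 1 + 1 ∧ ((i : ℕ) + 1) % 2 = 0) := by omega
          have h4 : (i : ℕ) + 1 = k + 1 ∧ (k : ℕ) % 2 = 0 := by omega
          rw [if_neg h3, if_pos h4, if_pos hik, hik]
          ring
        · have h3 : ¬ ((k : ℕ) = i + 1 + 1 ∧ ((i : ℕ) + 1) % 2 = 0) := by omega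
          have h4 : ¬ ((i : ℕ) + 1 = k + 1 ∧ (k : ℕ) % 2 = 0) := by omega
          rw [if_neg h3, if_neg h4, if_neg hik, mul_zero]
      · intro j _ hj
        have h3 : ¬ ((j : ℕ) = i + 1 ∧ (i : ℕ) % 2 = 0) := fun h => hj (Fin.ext h.1)
        have h4 : ¬ ((i : ℕ) = j + 1 ∧ (j : ℕ) % 2 = 0) := by omega
        simp [regularRot, h3, h4]
      · simp
    · have h2 : ¬ (i : ℕ) / 2 < N / 2 := by omega
      rw [Finset.sum_eq_zero]
      · simp [regularRotSq, h2]
      · intro j _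
        have h3 : ¬ ((j : ℕ) = i + 1 ∧ (i : ℕ) % 2 = 0) := by omega
        have h4 : ¬ ((i : ℕ) = j + 1 ∧ (j : ℕ) % 2 = 0) := by omega
        simp [regularRot, h3, h4]
  · have hi' : (i : ℕ) - 1 < N := by omega
    rw [Finset.sum_eq_single ⟨i - 1, hi'⟩]
    · have h1 : ((i : ℕ) - 1) / 2 = (i : ℕ) / 2 := by omega
      have h2 : (i : ℕ) / 2 < N / 2 := by omega
      have h3 : ¬ ((i : ℕ) - 1 = i + 1 ∧ (i : ℕ) % 2 = 0) := by omega
      have h4 : (i : ℕ) = i - 1 + 1 ∧ ((i : ℕ) - 1) % 2 = 0 := by omega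
      simp only [regularRot, of_apply, regularRotSq, Fin.ext_iff, h1, h2, if_neg h3, if_pos h4]
      by_cases hik : (i : ℕ) = k
      · have h5 : (k : ℕ) = i - 1 + 1 ∧ ((i : ℕ) - 1) % 2 = 0 := by omega
        rw [if_pos h5, if_pos hik]
        simp
        ring
      · have h5 : ¬ ((k : ℕ) = i - 1 + 1 ∧ ((i : ℕ) - 1) % 2 = 0) := by omega
        have h6 : ¬ ((i : ℕ) - 1 = k + 1 ∧ (k : ℕ) % 2 = 0) := by omega
        rw [if_neg h5, if_neg h6, if_neg hik, mul_zero]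
    · intro j _ hj
      have h3 : ¬ ((j : ℕ) = i + 1 ∧ (i : ℕ) % 2 = 0) := by omega
      have h4 : ¬ ((i : ℕ) = j + 1 ∧ (j : ℕ) % 2 = 0) := fun h => hj (Fin.ext (by simp; omega))
      simp [regularRot, h3, h4]
    · simp

/-- Distinct positive integers have distinct squares, and the unpaired index of odd `N` carries `0`,
unlike the negative values of the blocks. -/
theorem regularRotSq_ne {i k : Fin N} (h : (i : ℕ) / 2 ≠ (k : ℕ) / 2) :
    regularRotSq i ≠ regularRotSq k := by
  have hpos : ∀ a : ℕ, 0 < ((a : ℝ) + 1) ^ 2 := fun a => by positivity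
  have hinj : ∀ a b : ℕ, ((a : ℝ) + 1) ^ 2 = ((b : ℝ) + 1) ^ 2 → a = b := fun a b hab => by
    have := (pow_left_inj₀ (by positivity) (by positivity) two_ne_zero).1 hab
    exact_mod_cast add_right_cancel this
  unfold regularRotSq
  split_ifs with h1 h2 h2
  · exact fun h3 => h (hinj _ _ (neg_injective h3))
  · exact (neg_neg_of_pos (hpos _)).ne
  · exact (neg_neg_of_pos (hpos _)).ne'
  · omega

/-- The first index of a block of `regularRot`. -/
def fstIdx (b : Fin (N / 2)) : Fin N := ⟨2 * b, by omega⟩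

/-- The second index of a block of `regularRot`. -/
def sndIdx (b : Fin (N / 2)) : Fin N := ⟨2 * b + 1, by omega⟩

theorem regularRot_fst_snd (b : Fin (N / 2)) :
    regularRot N (fstIdx b) (sndIdx b) = (b : ℝ) + 1 := by
  simp [regularRot, fstIdx, sndIdx]

theorem regularRotSq_snd (b : Fin (N / 2)) : regularRotSq (sndIdx b) = -((b : ℝ) + 1) ^ 2 := by
  have h1 : (2 * (b : ℕ) + 1) / 2 = b := by omega
  simp [regularRotSq, sndIdx, h1]

/-- The centralizer of `regularRot` in `so N` meets the matrices that vanish on the blocks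
trivially. -/
theorem eq_zero_of_commute_regularRot {Z : Matrix (Fin N) (Fin N) ℝ} (hZ : Zᵀ = -Z)
    (hc : Z * regularRot N = regularRot N * Z) (hb : ∀ b, Z (fstIdx b) (sndIdx b) = 0) : Z = 0 := by
  have hZ' : ∀ i k, Z k i = -Z i k := fun i k => congrFun (congrFun hZ i) k
  -- Commuting with the square, a diagonal matrix with different values on different blocks, kills
  -- all entries between blocks. Within a block skewness leaves one entry, covered by `hb`.
  have hc2 : Z * diagonal regularRotSq = diagonal regularRotSq * Z := by
    rw [← regularRot_mul_self, ← mul_assoc, hc, mul_assoc, hc, mul_assoc]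
  have hlt : ∀ i k : Fin N, (i : ℕ) < k → Z i k = 0 := by
    intro i k hik
    by_cases h : (i : ℕ) / 2 = (k : ℕ) / 2
    · have h1 : i = fstIdx ⟨(i : ℕ) / 2, by omega⟩ := Fin.ext (by simp [fstIdx]; omega)
      have h2 : k = sndIdx ⟨(i : ℕ) / 2, by omega⟩ := Fin.ext (by simp [sndIdx]; omega)
      rw [h2]
      nth_rewrite 1 [h1]
      exact hb _
    · have h1 := congrFun (congrFun hc2 i) k
      rw [mul_diagonal, diagonal_mul, mul_comm] at h1
      by_contra hz
      exact regularRotSq_ne h (mul_right_cancel₀ hz h1).symm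
  ext i k
  rcases lt_trichotomy (i : ℕ) k with h | h | h
  · exact hlt i k h
  · obtain rfl := Fin.ext h
    have := hZ' i i
    simp only [Matrix.zero_apply]
    linarith
  · rw [hZ' k i, hlt k i h]
    simp

/-- A functional at which the commutator matrix has maximal rank. -/
noncomputable def regularDual (N : ℕ) : QHa N →ₗ[ℝ] ℝ where
  toFun z := z.T - (regularRot N * z.J.1).trace / 2
  map_add' y z := by
    simp [mul_add]
    ring
  map_smul' c z := by
    simp
    ring

theorem regularDual_apply (z : QHa N) :
    regularDual N z = z.T - (regularRot N * z.J.1).trace / 2 := rfl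

/-- Linear functions that separate the points of the stabilizer of `regularDual`. -/
noncomputable def stabilizerCoord (N : ℕ) : Fin (N / 2) ⊕ Fin 4 → QHa N →ₗ[ℝ] ℝ :=
  Sum.elim
    (fun b => { toFun := fun z => z.J.1 (fstIdx b) (sndIdx b)
                map_add' := fun _ _ => rfl
                map_smul' := fun _ _ => rfl })
    ![{ toFun := fun z => z.T, map_add' := fun _ _ => rfl, map_smul' := fun _ _ => rfl },
      { toFun := fun z => z.L, map_add' := fun _ _ => rfl, map_smul' := fun _ _ => rfl },
      { toFun := fun z => z.A, map_add' := fun _ _ => rfl, map_smul' := fun _ _ => rfl },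
      { toFun := fun z => z.M, map_add' := fun _ _ => rfl, map_smul' := fun _ _ => rfl }]

/-- Testing against rotations puts `z.J` in the centralizer of `regularRot`. Since the functional
sees `T`, the pairings of `G` with `Q`, `F` with `P` and `E` with `R` are nondegenerate, and testing
against one partner kills the other. -/
theorem eq_zero_of_mem_stabilizer {z : QHa N} (h : ∀ y : QHa N, regularDual N ⁅y, z⁆ = 0)
    (hz : ∀ a, stabilizerCoord N a z = 0) : z = 0 := by
  have hdot : ∀ v : Fin N → ℝ, (∀ u, u ⬝ᵥ v = 0) → v = 0 := fun v hv =>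
    dotProduct_self_eq_zero.1 (hv v)
  have hC : z.J.1 * regularRot N - regularRot N * z.J.1 = 0 := by
    set C := z.J.1 * regularRot N - regularRot N * z.J.1 with hCdef
    have hCt : Cᵀ = -C := by
      rw [hCdef, transpose_sub, transpose_mul, transpose_mul, transpose_J, transpose_regularRot]
      noncomm_ring
    ext i k
    have h1 := h (genJ (rot i k))
    -- Invariance of the trace form moves the commutator off the test rotation.
    have h2 : (regularRot N * ((rot i k).1 * z.J.1 - z.J.1 * (rot i k).1)).trace =
        ((rot i k).1 * C).trace := by
      rw [mul_sub, trace_sub, hCdef, mul_sub, trace_sub, ← mul_assoc, ← mul_assoc,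
        ← mul_assoc, ← mul_assoc, trace_mul_cycle (rot i k).1 z.J.1,
        trace_mul_cycle (regularRot N) z.J.1]
    have h3 : (⁅genJ (rot i k), z⁆).J.1 = (rot i k).1 * z.J.1 - z.J.1 * (rot i k).1 := rfl
    have h4 : (⁅genJ (rot i k), z⁆).T = 0 := by simp [lie_eq, genJ, mk']
    have h5 : C k i = -C i k := congrFun (congrFun hCt i) k
    rw [regularDual_apply, h3, h2, h4, trace_rot_mul] at h1
    rw [Matrix.zero_apply]
    linarith
  have hJ : z.J = 0 := by
    apply Subtype.ext
    exact eq_zero_of_commute_regularRot (transpose_J z) (sub_eq_zero.1 hC)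
      (fun b => hz (Sum.inl b))
  apply ext_components
  · exact hJ
  · refine hdot _ fun u => ?_
    simpa [regularDual_apply, lie_eq, genQ, mk', hJ, dotProduct_comm] using h (genQ u)
  · refine hdot _ fun u => ?_
    simpa [regularDual_apply, lie_eq, genP, mk', hJ, dotProduct_comm] using h (genP u)
  · refine hdot _ fun u => ?_
    simpa [regularDual_apply, lie_eq, genF, mk', hJ, dotProduct_comm] using h (genF u)
  · refine hdot _ fun u => ?_
    simpa [regularDual_apply, lie_eq, genG, mk', hJ, dotProduct_comm] using h (genG u)
  · simpa [regularDual_apply, lie_eq, genE, mk', hJ] using h genE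
  · simpa [regularDual_apply, lie_eq, genR, mk', hJ] using h genR
  · exact hz (Sum.inr 0)
  · exact hz (Sum.inr 1)
  · exact hz (Sum.inr 2)
  · exact hz (Sum.inr 3)

theorem coordJ_regularDual : coordJ (regularDual N) = regularRot N := by
  ext i k
  change (0 : ℝ) - (regularRot N * (rot i k).1).trace / 2 = _
  rw [trace_mul_comm, trace_rot_mul, regularRot_swap]
  ring

theorem coordG_regularDual : coordG (regularDual N) = 0 := by
  ext k; simp [coordG, regularDual_apply, genG, mk']

theorem coordF_regularDual : coordF (regularDual N) = 0 := by
  ext k; simp [coordF, regularDual_apply, genF, mk']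

theorem coordP_regularDual : coordP (regularDual N) = 0 := by
  ext k; simp [coordP, regularDual_apply, genP, mk']

theorem coordQ_regularDual : coordQ (regularDual N) = 0 := by
  ext k; simp [coordQ, regularDual_apply, genQ, mk']

theorem pfaffianDeriv_regularDual (η : QHa N →ₗ[ℝ] ℝ) :
    pfaffianDeriv (regularDual N) η = 2 * η genT := by
  simp [pfaffianDeriv, regularDual_apply, genR, genT, genL, genA, genM, mk']

theorem invRot_regularDual : invRot (regularDual N) = regularRot N := by
  simp [invRot, coordG_regularDual, coordF_regularDual, coordP_regularDual,
    wedge_zero_left, coordJ_regularDual, pfaffian, regularDual_apply, genR, genT, genL, genA, mk']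

/-- The vector coordinates vanish at the base point, so every wedge has zero derivative; the
Pfaffian is `1` there and constant to first order in a rotation direction. -/
theorem invRotDeriv_regularDual (b : Fin (N / 2)) :
    invRotDeriv (regularDual N) (stabilizerCoord N (Sum.inl b)) =
      coordJ (stabilizerCoord N (Sum.inl b)) := by
  set η := stabilizerCoord N (Sum.inl b) with hη
  have hG : coordG η = 0 := by ext; rfl
  have hF : coordF η = 0 := by ext; rfl
  have hP : coordP η = 0 := by ext; rfl
  have hT : η genT = 0 := rfl
  have hp : pfaffian (regularDual N) = 1 := by
    simp [pfaffian, regularDual_apply, genR, genT, genL, genA, mk']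
  simp [invRotDeriv, coordG_regularDual, coordF_regularDual, coordP_regularDual,
    coordQ_regularDual, wedge_zero_left, hG, hF, hP, hT, hp, pfaffianDeriv_regularDual]

/-- The direction reads off one block entry, and an odd power of `regularRot` is `regularRot` times
a power of its diagonal square. The result is a `k`-th power of a node depending on `b`: a
Vandermonde matrix up to factors. -/
theorem trace_regularRot_pow_mul (k : ℕ) (b : Fin (N / 2)) :
    (regularRot N ^ (2 * k + 1) * coordJ (stabilizerCoord N (Sum.inl b))).trace =
      -2 * (((b : ℝ) + 1) * (-((b : ℝ) + 1) ^ 2) ^ k) := by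
  have hskew : regularRot N ^ (2 * k + 1) ∈ LieAlgebra.Orthogonal.so (Fin N) ℝ := by
    rw [LieAlgebra.Orthogonal.mem_so, transpose_pow, transpose_regularRot,
      Odd.neg_pow (odd_two_mul_add_one k)]
  have h1 : (regularRot N ^ (2 * k + 1)) (fstIdx b) (sndIdx b) =
      -(regularRot N ^ (2 * k + 1) * coordJ (stabilizerCoord N (Sum.inl b))).trace / 2 :=
    apply_genJ (stabilizerCoord N (Sum.inl b)) ⟨_, hskew⟩
  have h2 : (regularRot N ^ (2 * k + 1)) (fstIdx b) (sndIdx b) =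
      ((b : ℝ) + 1) * (-((b : ℝ) + 1) ^ 2) ^ k := by
    rw [pow_succ', pow_mul, pow_two, regularRot_mul_self, diagonal_pow, mul_diagonal,
      regularRot_fst_snd, Pi.pow_apply, regularRotSq_snd]
  linarith

/-- The differentials of the invariants are linearly independent at `regularDual`. -/
theorem eq_zero_of_sum_invariantDeriv {c : Fin (N / 2) ⊕ Fin 4 → ℝ}
    (h : ∀ a, ∑ e, c e * invariantDeriv (regularDual N) (stabilizerCoord N a) e = 0) : c = 0 := by
  have hl : ∀ k, c (Sum.inl k) = 0 := by
    have hinj : Function.Injective fun b : Fin (N / 2) => -((b : ℝ) + 1) ^ 2 := fun b b' hb => by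
      have := (pow_left_inj₀ (by positivity) (by positivity) two_ne_zero).1 (neg_injective hb)
      exact Fin.ext (by exact_mod_cast add_right_cancel this)
    -- The exponent factor `2k + 2` is absorbed into the unknowns, leaving a Vandermonde system with
    -- nodes `-(b + 1)²`.
    have h1 : (fun k : Fin (N / 2) => c (Sum.inl k) * ((2 * (k : ℕ) + 1 : ℕ) + 1 : ℝ)) = 0 := by
      refine eq_zero_of_forall_index_sum_mul_pow_eq_zero hinj fun b => ?_
      have h2 := h (Sum.inl b)
      simp only [Fintype.sum_sum_type, invariantDeriv, Sum.elim_inl, Sum.elim_inr,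
        invRot_regularDual, invRotDeriv_regularDual, trace_regularRot_pow_mul] at h2
      -- The other four invariants are stationary in rotation directions, so the Jacobian is block
      -- triangular.
      have h3 : ∀ a : Fin 4, ![pfaffianDeriv (regularDual N) (stabilizerCoord N (Sum.inl b)),
          stabilizerCoord N (Sum.inl b) genL, stabilizerCoord N (Sum.inl b) genA,
          stabilizerCoord N (Sum.inl b) genM] a = 0 := by
        intro a
        fin_cases a
        · exact (pfaffianDeriv_regularDual _).trans (mul_zero 2)
        all_goals rfl
      simp only [h3, mul_zero, Finset.sum_const_zero, add_zero] at h2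
      have h4 : (-2 * ((b : ℝ) + 1)) ≠ 0 := by positivity
      refine (mul_eq_zero.1 ?_).resolve_left h4
      rw [← h2, Finset.mul_sum]
      exact Finset.sum_congr rfl fun k _ => by ring
    intro k
    exact (mul_eq_zero.1 (congrFun h1 k)).resolve_right (by positivity)
  funext a
  rcases a with k | a
  · exact hl k
  -- With the trace coefficients gone, the remaining block is `diag(2, 1, 1, 1)` in the directions
  -- `T, L, A, M`.
  · have h1 := h (Sum.inr a)
    simp only [Fintype.sum_sum_type, hl, zero_mul, Finset.sum_const_zero, zero_add,
      Fin.sum_univ_four, invariantDeriv, Sum.elim_inr, pfaffianDeriv_regularDual] at h1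
    fin_cases a
    · change c (Sum.inr 0) * (2 * 1) + c (Sum.inr 1) * 0 + c (Sum.inr 2) * 0
        + c (Sum.inr 3) * 0 = 0 at h1
      change c (Sum.inr 0) = 0
      linarith
    · change c (Sum.inr 0) * (2 * 0) + c (Sum.inr 1) * 1 + c (Sum.inr 2) * 0
        + c (Sum.inr 3) * 0 = 0 at h1
      change c (Sum.inr 1) = 0
      linarith
    · change c (Sum.inr 0) * (2 * 0) + c (Sum.inr 1) * 0 + c (Sum.inr 2) * 1
        + c (Sum.inr 3) * 0 = 0 at h1
      change c (Sum.inr 2) = 0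
      linarith
    · change c (Sum.inr 0) * (2 * 0) + c (Sum.inr 1) * 0 + c (Sum.inr 2) * 0
        + c (Sum.inr 3) * 1 = 0 at h1
      change c (Sum.inr 3) = 0
      linarith

end QHa

/-! ### Conclusion. -/

theorem lemma2 (N : ℕ) (hN : 3 ≤ N) {ι : Type*} [Fintype ι] [DecidableEq ι]
    (X : Module.Basis ι ℝ (QHa N)) :
    LieInvariants.invariantNumber X = N / 2 + 4 ∧
      ∀ U : Set (ι → ℝ), IsOpen U → U.Nonempty →
        LieInvariants.IsMaxNumberOfInvariantsOn X U (N / 2 + 4) := by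
  have hcard : Fintype.card (Fin (N / 2) ⊕ Fin 4) = N / 2 + 4 := by simp
  have hA : ∀ a x, AnalyticAt ℝ (fun y => QHa.invariant N a (LieInvariants.ofCoord X y)) x :=
    fun a x => QHa.analyticAt_invariant (fun z => LieInvariants.analyticAt_ofCoord X z x) a
  have hd : ∀ a x v, fderiv ℝ (fun y => QHa.invariant N a (LieInvariants.ofCoord X y)) x v =
      QHa.invariantDeriv (LieInvariants.ofCoord X x) (LieInvariants.ofCoord X v) a := fun a x v =>
    LieInvariants.fderiv_comp_ofCoord X (hA a x) (QHa.hasDerivAt_invariant _ _ a)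
  rw [← hcard]
  refine LieInvariants.number_of_invariants X hA (fun a i x => ?_)
    (x₀ := fun k => QHa.regularDual N (X k)) ?_ ?_
  · rw [LieInvariants.analyticRealization_eq, hd, LieInvariants.ofCoord_commutatorMatrix]
    exact QHa.invariantDeriv_coad _ _ a
  · rw [Fintype.linearIndependent_iff]
    intro c hc
    refine congrFun (QHa.eq_zero_of_sum_invariantDeriv fun a => ?_)
    -- The coordinates that separate the stabilizer serve a second time, as the tangent directions
    -- on which the differentials are tested.
    have := congrArg (fun f => f fun k => QHa.stabilizerCoord N a (X k)) hc
    simpa [hd, LieInvariants.ofCoord_dual] using this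
  · exact LieInvariants.card_le_rank_add X _ (LinearMap.pi (QHa.stabilizerCoord N))
      fun z hz hz' => QHa.eq_zero_of_mem_stabilizer hz fun a => congrFun hz' a
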